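/- Let $\mathfrak H$ be a complex Hilbert space, let $(\sigma,\tau)\subseteq\mathbb R$ be an open (possibly unbounded) interval, and let $F$ assign to each $\lambda\in(\sigma,\tau)$ an operator $F(\lambda)$ in $\mathfrak H$ such that: (i) every $F(\lambda)$ is self-adjoint with compact resolvent; (ii) every $\lambda_0\in(\sigma,\tau)$ has a neighbourhood $U\subseteq(\sigma,\tau)$ and a real number $\mu$ such that $\langle F(\lambda)y,y\rangle\ge\mu\|y\|^2$ for all $\lambda\in U$ and $y\in\operatorname{dom}F(\lambda)$; (iii) $\lambda\mapsto(F(\lambda)-i)^{-1}$ is continuous on $(\sigma,\tau)$ in the operator norm. A number $\lambda_0\in(\sigma,\tau)$ is called an eigenvalue of $F$ of multiplicity $m$ if $0$ is an eigenvalue of $F(\lambda_0)$ of multiplicity $m$; an eigenpair of $F$ is a pair $(\lambda_0,y_0)$ with $\lambda_0\in(\sigma,\tau)$, $0\ne y_0\in\operatorname{dom}F(\lambda_0)$ and $F(\lambda_0)y_0=0$. For $\xi_1<\xi_2$ in $(\sigma,\tau)$ let $\mathcal N_F(\xi_1,\xi_2)$ be the number of eigenvalues of $F$ in $[\xi_1,\xi_2)$,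 and for $\xi\in(\sigma,\tau)$ let $\nu_F(\xi)$ be the number of negative eigenvalues of $F(\xi)$, both counted with multiplicity. For $\lambda\in(\sigma,\tau)$ let $\mathfrak f(\lambda)[\cdot]$ be the closure of the quadratic form $y\mapsto\langle F(\lambda)y,y\rangle$ on $\operatorname{dom}F(\lambda)$. Assume that: (a) the domain of $\mathfrak f(\lambda)$ is a subspace $\mathfrak D(\mathfrak f)$ independent of $\lambda\in(\sigma,\tau)$; (b) for every $\lambda\in(\sigma,\tau)$ there is a quadratic form $\mathfrak f'(\lambda)[\cdot]$ with domain $\mathfrak D(\mathfrak f)$ such that, for every $y\in\mathfrak D(\mathfrak f)$, the function $\lambda\mapsto\mathfrak f(\lambda)[y]$ is differentiable on $(\sigma,\tau)$ with derivative $\lambda\mapsto\mathfrak f'(\lambda)[y]$; (c) the forms $\mathfrak f'(\lambda)$ are bounded uniformly in $\lambda\in(\sigma,\tau)$: there are a norm $p$ on $\mathfrak D(\mathfrak f)$ with respect to which $\mathfrak D(\mathfrak f)$ is complete (for example the form norm $(\mathfrak f(\lambda_*)[y]-\mu\|y\|^2)^{1/2}$ for some $\lambda_*\in(\sigma,\tau)$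 and some real $\mu$ strictly below the lower bound of $\mathfrak f(\lambda_*)$) and a constant $C$ such that $|\mathfrak f'(\lambda)[y]|\le C\,p(y)^2$ for all $\lambda\in(\sigma,\tau)$ and $y\in\mathfrak D(\mathfrak f)$; (d) $\mathfrak f'(\lambda_0)[y_0]<0$ for every eigenpair $(\lambda_0,y_0)$ of $F$. Then, for all $\xi_1<\xi_2$ in $(\sigma,\tau)$, the numbers $\mathcal N_F(\xi_1,\xi_2)$, $\nu_F(\xi_1)$ and $\nu_F(\xi_2)$ are finite and $$\mathcal N_F(\xi_1,\xi_2)=\nu_F(\xi_2)-\nu_F(\xi_1).$$ -/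

import Mathlib

open Filter Topology

/-- `R` is the (everywhere defined, bounded) resolvent `(A - z)⁻¹` of the unbounded operator `A`:
for all `x y`, one has `x ∈ dom A` and `A x - z x = y` if and only if `x = R y`. -/
def IsResolventOf {H : Type*} [NormedAddCommGroup H] [InnerProductSpace ℂ H]
    (A : H →ₗ.[ℂ] H) (z : ℂ) (R : H →L[ℂ] H) : Prop :=
  ∀ x y : H, (∃ hx : x ∈ A.domain, A ⟨x, hx⟩ - z • x = y) ↔ x = R y

/-- The operator `A` has compact resolvent: its resolvent set is nonempty and the resolvent is a
compact operator there. -/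
def HasCompactResolvent {H : Type*} [NormedAddCommGroup H] [InnerProductSpace ℂ H]
    (A : H →ₗ.[ℂ] H) : Prop :=
  ∃ (z : ℂ) (R : H →L[ℂ] H), IsResolventOf A z R ∧ IsCompactOperator R

/-- The eigenspace of the unbounded operator `A` at the real number `t`. -/
def unboundedEigenspace {H : Type*} [NormedAddCommGroup H] [InnerProductSpace ℂ H]
    (A : H →ₗ.[ℂ] H) (t : ℝ) : Submodule ℂ A.domain :=
  LinearMap.ker (A.toFun - (t : ℂ) • A.domain.subtype)

/-- The multiplicity of `t` as an eigenvalue of `A` (equal to `0` if `t` is not an eigenvalue). -/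
noncomputable def eigenMultiplicity {H : Type*} [NormedAddCommGroup H] [InnerProductSpace ℂ H]
    (A : H →ₗ.[ℂ] H) (t : ℝ) : ℕ∞ :=
  Cardinal.toENat (Module.rank ℂ (unboundedEigenspace A t))

/-- The number of negative eigenvalues of `A`, counted with multiplicity. -/
noncomputable def negEigenvalueCount {H : Type*} [NormedAddCommGroup H] [InnerProductSpace ℂ H]
    (A : H →ₗ.[ℂ] H) : ℕ∞ :=
  ∑' t : Set.Iio (0 : ℝ), eigenMultiplicity A t

/-- The number of eigenvalues of the operator function `F` in `[ξ₁, ξ₂)`, counted with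
multiplicity: `s` is an eigenvalue of `F` of multiplicity `m` when `0` is an eigenvalue of `F s`
of multiplicity `m`. -/
noncomputable def familyEigenvalueCount {H : Type*} [NormedAddCommGroup H]
    [InnerProductSpace ℂ H] (F : ℝ → H →ₗ.[ℂ] H) (ξ₁ ξ₂ : ℝ) : ℕ∞ :=
  ∑' s : Set.Ico ξ₁ ξ₂, eigenMultiplicity (F s) 0

/-- The open interval `(σ, τ) ⊆ ℝ`, whose end points may be infinite. -/
def realInterval (σ τ : EReal) : Set ℝ := {s : ℝ | σ < (s : EReal) ∧ (s : EReal) < τ}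

/-- The standing properties of an operator function `F` on the set `I` of real numbers. The values
of `F` outside `I` play no role. -/
structure IsSelfAdjointFamily {H : Type*} [NormedAddCommGroup H] [InnerProductSpace ℂ H]
    [CompleteSpace H] (I : Set ℝ) (F : ℝ → H →ₗ.[ℂ] H) : Prop where
  /-- The values are self-adjoint operators. -/
  selfAdjoint : ∀ s ∈ I, IsSelfAdjoint (F s)
  /-- The values have compact resolvent. -/
  compactResolvent : ∀ s ∈ I, HasCompactResolvent (F s)
  /-- The values are locally uniformly bounded below: `F t - μ` is nonnegative near `s`. -/
  locallyBoundedBelow : ∀ s ∈ I, ∃ μ : ℝ, ∃ U ∈ 𝓝 s, U ⊆ I ∧ ∀ t ∈ U, ∀ y : (F t).domain,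
    μ * ‖(y : H)‖ ^ 2 ≤ (inner ℂ (F t y) (y : H)).re
  /-- `(F s - i)⁻¹` depends continuously on `s ∈ I` in the operator norm. -/
  resolventContinuous : ∃ R : ℝ → H →L[ℂ] H,
    (∀ s ∈ I, IsResolventOf (F s) Complex.I (R s)) ∧ ContinuousOn R I

/-- The sequence `u` in the domain of `A` converges to `y` in the sense of the quadratic form
`q[x] = ⟨A x, x⟩`: `u n → y` in `H` and `q[u n - u m] → 0` as `n, m → ∞`. -/
def FormConverges {H : Type*} [NormedAddCommGroup H] [InnerProductSpace ℂ H]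
    (A : H →ₗ.[ℂ] H) (u : ℕ → A.domain) (y : H) : Prop :=
  Tendsto (fun n => (u n : H)) atTop (𝓝 y) ∧
    Tendsto (fun n : ℕ × ℕ => inner ℂ (A (u n.1 - u n.2)) ((u n.1 - u n.2 : A.domain) : H))
      atTop (𝓝 0)

/-- The form `f` with domain `D` (a sesquilinear form, whose quadratic form is `f y y`) is the
closure of the quadratic form `⟨A x, x⟩` on `dom A`: the domain `D` consists of the limits of
all sequences in `dom A` convergent in the sense of the form, and `f y y` is the limit of the
values of the form along every such sequence. -/
structure IsFormClosure {H : Type*} [NormedAddCommGroup H] [InnerProductSpace ℂ H]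
    (A : H →ₗ.[ℂ] H) (D : Submodule ℂ H) (f : D →ₗ⋆[ℂ] D →ₗ[ℂ] ℂ) : Prop where
  mem_iff : ∀ y : H, y ∈ D ↔ ∃ u : ℕ → A.domain, FormConverges A u y
  tendsto : ∀ (u : ℕ → A.domain) (y : D), FormConverges A u (y : H) →
    Tendsto (fun n => inner ℂ (A (u n)) (u n : H)) atTop (𝓝 (f y y))

/-- `p` is a norm with respect to which the vector space `D` is complete. -/
structure IsCompleteNorm {D : Type*} [AddCommGroup D] [Module ℂ D] (p : Seminorm ℂ D) : Prop where
  eq_zero : ∀ y : D, p y = 0 → y = 0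
  complete : ∀ u : ℕ → D, Tendsto (fun n : ℕ × ℕ => p (u n.1 - u n.2)) atTop (𝓝 0) →
    ∃ y : D, Tendsto (fun n => p (u n - y)) atTop (𝓝 0)

/-!
The number of negative eigenvalues of `F s` can change only where `F s` has a kernel, and there
the sign of the derivative of the forms decides in which direction it changes.

For `s` in the interval choose `μ < 0` strictly below the lower bound of `F s`, and let `S` be the
square root of the compact positive operator `R = (F s - μ)⁻¹`. The range of `S` is the form
domain `D`, and in the coordinates `x ↦ S x` the form `f s` is that of the bounded operator
`1 + μ R` (`IsFormClosure.mem_iff_mem_range`, `IsFormClosure.apply_self_eq`). The spectral theory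
of the compact operator `R` splits the coordinate space into a finite-dimensional part where the
form is negative definite, the kernel, and a part where it is uniformly positive; the dimension of
the first is the number of negative eigenvalues of `F s` (`IsFormClosure.nonempty_formSplitting`).

Near a fixed `s`, all forms `f t` are read in the coordinates at `s`, where they are bounded by
the closed graph theorem. By differentiability their difference quotients at `s` converge
pointwise, so by the Banach–Steinhaus theorem they are bounded in norm along every sequence
tending to `s`. Hence the definite parts at `s` stay definite for `f t`, and the kernel, on which
the derivative is negative, can be joined to the negative part for `t > s` and to the positive
part for `t < s` (`eventually_re_inner_pos_of_tendsto_slope`). Comparison of dimensions gives that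
the negative eigenvalue count is constant on the left of `s` up to `s`, jumps to the right of `s`
by the multiplicity of the eigenvalue `s`, and that there are no other eigenvalues of `F` near `s`
(`eventually_negEigenvalueCount_eq`). As the interval is connected, these jumps add up to the
asserted identity (`tsum_Ico_add_eq_of_eventually`).
-/

/-! ### Dimensions of complements and of independent families -/

section LinearAlgebra

variable {V : Type*} [AddCommGroup V] [Module ℂ V]

theorem finrank_le_of_disjoint_of_isCompl {U W Q : Submodule ℂ V} [FiniteDimensional ℂ W]
    (hWQ : IsCompl W Q) (hUQ : Disjoint U Q) :
    Module.finrank ℂ U ≤ Module.finrank ℂ W := by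
  have hinj : Function.Injective (Q.mkQ.comp U.subtype) := by
    rw [← LinearMap.ker_eq_bot, LinearMap.ker_comp, Submodule.ker_mkQ,
      ← Submodule.disjoint_iff_comap_eq_bot]
    exact hUQ
  have e := Submodule.quotientEquivOfIsCompl Q W hWQ.symm
  have : Module.Finite ℂ (V ⧸ Q) := Module.Finite.equiv e.symm
  exact (LinearMap.finrank_le_finrank_of_injective hinj).trans e.finrank_eq.le

theorem finrank_sup_eq_sum {ι : Type*} {E : ι → Submodule ℂ V} (hE : iSupIndep E)
    [∀ i, FiniteDimensional ℂ (E i)] (Z : Finset ι) :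
    Module.finrank ℂ (Z.sup E : Submodule ℂ V) = ∑ i ∈ Z, Module.finrank ℂ (E i) := by
  classical
  induction Z using Finset.induction_on with
  | empty => simp
  | insert i Z hi ih =>
    have hdisj : Disjoint (E i) (Z.sup E) := hE.supIndep' (insert i Z) (Finset.subset_insert i Z)
      (Finset.mem_insert_self i Z) hi
    rw [Finset.sup_insert, Finset.sum_insert hi, ← ih]
    have := Submodule.finrank_sup_add_finrank_inf_eq (E i) (Z.sup E)
    rw [hdisj.eq_bot, finrank_bot] at this
    simpa using this

theorem finite_ne_bot_of_iSupIndep {ι : Type*} {E : ι → Submodule ℂ V} (hE : iSupIndep E)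
    [FiniteDimensional ℂ (⨆ i, E i : Submodule ℂ V)] : {i | E i ≠ ⊥}.Finite := by
  have hfin : ∀ i, FiniteDimensional ℂ (E i) := fun i =>
    Submodule.finiteDimensional_of_le (le_iSup E i)
  by_contra h
  obtain ⟨Z, hZ, hcard⟩ := Set.Infinite.exists_subset_card_eq h
    (Module.finrank ℂ (⨆ i, E i : Submodule ℂ V) + 1)
  have h1 : Module.finrank ℂ (Z.sup E : Submodule ℂ V) ≤
      Module.finrank ℂ (⨆ i, E i : Submodule ℂ V) :=
    Submodule.finrank_mono (Finset.sup_le fun i _ => le_iSup E i)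
  rw [finrank_sup_eq_sum hE] at h1
  have h2 : Z.card ≤ ∑ i ∈ Z, Module.finrank ℂ (E i) := by
    rw [Finset.card_eq_sum_ones]
    refine Finset.sum_le_sum fun i hi => ?_
    exact Submodule.one_le_finrank_iff.2 (hZ hi)
  omega

theorem tsum_toENat_rank_eq_finrank_iSup {ι : Type*} {E : ι → Submodule ℂ V} (hE : iSupIndep E)
    [FiniteDimensional ℂ (⨆ i, E i : Submodule ℂ V)] :
    ∑' i, Cardinal.toENat (Module.rank ℂ (E i)) =
      (Module.finrank ℂ (⨆ i, E i : Submodule ℂ V) : ℕ∞) := by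
  have hfin : ∀ i, FiniteDimensional ℂ (E i) := fun i =>
    Submodule.finiteDimensional_of_le (le_iSup E i)
  have hZ := finite_ne_bot_of_iSupIndep hE
  have hrank : ∀ i, Cardinal.toENat (Module.rank ℂ (E i)) = (Module.finrank ℂ (E i) : ℕ∞) := by
    intro i
    rw [← Module.finrank_eq_rank, Cardinal.toENat_nat]
  have hsup : hZ.toFinset.sup E = ⨆ i, E i := by
    refine le_antisymm (Finset.sup_le fun i _ => le_iSup E i) (iSup_le fun i => ?_)
    by_cases hi : E i = ⊥
    · simp [hi]
    · exact Finset.le_sup (f := E) (hZ.mem_toFinset.2 hi)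
  rw [tsum_eq_sum (s := hZ.toFinset), ← hsup, finrank_sup_eq_sum hE, Nat.cast_sum]
  · exact Finset.sum_congr rfl fun i _ => hrank i
  · intro i hi
    have : E i = ⊥ := by simpa using hi
    rw [hrank, this, finrank_bot, Nat.cast_zero]

end LinearAlgebra

/-! ### Eigenspaces of compact operators and positivity -/

section CompactOperators

variable {H : Type*} [NormedAddCommGroup H] [InnerProductSpace ℂ H]

/-- A compact operator cannot be bounded below on an infinite-dimensional subspace: it would map a
bounded separated sequence to a separated sequence. The subspace need not be closed. -/
theorem finiteDimensional_of_isCompactOperator_of_le_norm {T : H →L[ℂ] H}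
    (hT : IsCompactOperator T) (V : Submodule ℂ H) {r : ℝ} (hr : 0 < r)
    (hV : ∀ x ∈ V, r * ‖x‖ ≤ ‖T x‖) : FiniteDimensional ℂ V := by
  by_contra h
  obtain ⟨C, u, hC, hu, hsep⟩ := exists_seq_norm_le_one_le_norm_sub (𝕜 := ℂ) (E := V) h
  obtain ⟨Q, hQ, hQ'⟩ := hT.image_closedBall_subset_compact C
  obtain ⟨y, -, φ, hφ, hy⟩ := hQ.tendsto_subseq
    (fun n => hQ' ⟨(u n : H), by simpa using hu n, rfl⟩)
  obtain ⟨N, hN⟩ := Metric.cauchySeq_iff'.1 hy.cauchySeq r hr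
  have h1 : dist (T (u (φ (N + 1)))) (T (u (φ N))) < r := hN (N + 1) (by omega)
  have h2 := hV _ (u (φ (N + 1)) - u (φ N)).2
  have h3 := hsep (hφ.injective.ne (show N + 1 ≠ N by omega))
  rw [dist_eq_norm, ← map_sub] at h1
  have h4 : 1 ≤ ‖((u (φ (N + 1)) - u (φ N) : V) : H)‖ := h3
  simp only [Submodule.coe_sub] at h2 h4
  have := h2.trans h1.le
  nlinarith

/-- If `T` acts as the scalar `a i` on `E i`, and the subspaces `E i` are pairwise orthogonal,
then a lower bound of the numbers `a i` is a lower bound of the quadratic form of `T` on the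
algebraic span of the `E i`. Only the `i` with `E i ≠ ⊥` matter. -/
theorem mul_norm_sq_le_re_inner_of_mem_iSup {ι : Type*} {E : ι → Submodule ℂ H} {T : H →L[ℂ] H}
    {a : ι → ℝ} {r : ℝ}
    (horth : ∀ i j, i ≠ j → ∀ x ∈ E i, ∀ y ∈ E j, inner ℂ x y = 0)
    (hT : ∀ i, ∀ x ∈ E i, T x = (a i : ℂ) • x) (hr : ∀ i, E i ≠ ⊥ → r ≤ a i) {x : H}
    (hx : x ∈ ⨆ i, E i) : r * ‖x‖ ^ 2 ≤ (inner ℂ (T x) x).re := by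
  obtain ⟨g, hg, rfl⟩ := (Submodule.mem_iSup_iff_exists_finsupp E x).1 hx
  have h1 : ∀ i, inner ℂ (g i) (g.sum fun _ y => y) = (‖g i‖ : ℂ) ^ 2 := by
    intro i
    rw [Finsupp.sum, inner_sum]
    rw [Finset.sum_eq_single i (fun j _ hj => horth i j hj.symm _ (hg i) _ (hg j))]
    · exact inner_self_eq_norm_sq_to_K _
    · intro hi
      simp [Finsupp.notMem_support_iff.1 hi]
  have h0 : (g.sum fun _ y => y) = ∑ i ∈ g.support, g i := rfl
  have h2 : inner ℂ (T (g.sum fun _ y => y)) (g.sum fun _ y => y)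
      = ((∑ i ∈ g.support, a i * ‖g i‖ ^ 2 : ℝ) : ℂ) := by
    nth_rw 1 [h0]
    rw [map_sum, sum_inner]
    push_cast
    refine Finset.sum_congr rfl fun i _ => ?_
    rw [hT i _ (hg i), inner_smul_left, h1]
    simp
  have h3 : ‖g.sum fun _ y => y‖ ^ 2 = ∑ i ∈ g.support, ‖g i‖ ^ 2 := by
    have : ((‖g.sum fun _ y => y‖ ^ 2 : ℝ) : ℂ) = ((∑ i ∈ g.support, ‖g i‖ ^ 2 : ℝ) : ℂ) := by
      push_cast
      refine (inner_self_eq_norm_sq_to_K (𝕜 := ℂ) (g.sum fun _ y => y)).symm.trans ?_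
      nth_rw 1 [h0]
      rw [sum_inner]
      exact Finset.sum_congr rfl fun i _ => h1 i
    exact_mod_cast this
  rw [h2, h3, Complex.ofReal_re, Finset.mul_sum]
  refine Finset.sum_le_sum fun i hi => ?_
  have : E i ≠ ⊥ := fun h => Finsupp.mem_support_iff.1 hi (by simpa [h] using hg i)
  exact mul_le_mul_of_nonneg_right (hr i this) (by positivity)

/-- A nonzero positive compact operator has its norm as an eigenvalue, so a strict bound of the
eigenvalues is a strict bound of the norm. -/
theorem opNorm_lt_of_isCompactOperator_of_forall_eigenvalue_lt [CompleteSpace H]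
    {T : H →L[ℂ] H} (hc : IsCompactOperator T) (hT : IsSelfAdjoint T)
    (hpos : ∀ x, 0 ≤ (inner ℂ (T x) x).re) {r : ℝ} (hr : 0 < r)
    (hlt : ∀ (a : ℝ) (x : H), T x = (a : ℂ) • x → x ≠ 0 → a < r) : ‖T‖ < r := by
  by_contra! h
  have hT0 : 0 < ‖T‖ := hr.trans_le h
  have : Nontrivial H := by
    by_contra hn
    rw [not_nontrivial_iff_subsingleton] at hn
    have : T = 0 := by ext x; exact Subsingleton.elim _ _
    simp [this] at hT0
  obtain ⟨k, hk, hk'⟩ := spectrum.exists_nnnorm_eq_spectralRadius T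
  rw [T.spectralRadius_eq_nnnorm hT, ENNReal.coe_inj] at hk'
  have hk' : ‖k‖ = ‖T‖ := congrArg NNReal.toReal hk'
  have hk0 : k ≠ 0 := by rw [← norm_pos_iff, hk']; exact hT0
  obtain ⟨x, hx⟩ := ((hc.hasEigenvalue_iff_mem_spectrum hk0).2 hk).exists_hasEigenvector
  have hTx : T x = k • x := hx.apply_eq_smul
  have hkre : ((k.re : ℝ) : ℂ) = k := by
    have := hT.isSymmetric.conj_eigenvalue_eq_self (Module.End.hasEigenvalue_of_hasEigenvector hx)
    exact Complex.conj_eq_iff_re.1 this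
  have h1 := hlt k.re x (by rw [hkre, hTx]) hx.2
  have h2 := hpos x
  rw [hTx, ← hkre, inner_smul_left, inner_self_eq_norm_sq_to_K] at h2
  have h3 : 0 < ‖x‖ := norm_pos_iff.2 hx.2
  have h4 : 0 ≤ k.re * ‖x‖ ^ 2 := by
    simpa [← Complex.ofReal_pow, ← Complex.ofReal_mul] using h2
  have h5 : 0 ≤ k.re := nonneg_of_mul_nonneg_left h4 (by positivity)
  have : ‖k‖ = k.re := by rw [← hkre, Complex.norm_real, Real.norm_of_nonneg h5]; simp
  linarith

end CompactOperators

/-! ### Perturbation of a quadratic form along its difference quotients -/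

section Perturbation

variable {H : Type*} [NormedAddCommGroup H] [InnerProductSpace ℂ H]

/-- Uniform boundedness for quadratic forms: by polarization the sesquilinear forms `⟪B n x, y⟫`
converge too, and the Banach–Steinhaus theorem applies twice. -/
theorem exists_norm_le_of_tendsto_inner_self [CompleteSpace H] {B : ℕ → H →L[ℂ] H} {b : H → ℂ}
    (h : ∀ x, Tendsto (fun n => inner ℂ (B n x) x) atTop (𝓝 (b x))) : ∃ C, ∀ n, ‖B n‖ ≤ C := by
  have hxy : ∀ x y, ∃ C, ∀ n, ‖inner ℂ (B n x) y‖ ≤ C := by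
    intro x y
    have h1 : Tendsto (fun n => inner ℂ (B n x) y) atTop
        (𝓝 ((b (x + y) - b (x - y) - Complex.I * b (x + Complex.I • y) +
          Complex.I * b (x - Complex.I • y)) / 4)) := by
      have h2 := ((((h (x + y)).sub (h (x - y))).sub
        ((h (x + Complex.I • y)).const_mul Complex.I)).add
        ((h (x - Complex.I • y)).const_mul Complex.I)).div_const 4
      refine h2.congr fun n => ?_
      exact (inner_map_polarization' (B n : H →ₗ[ℂ] H) x y).symm
    obtain ⟨C, hC⟩ := (Metric.isBounded_range_of_tendsto _ h1).exists_norm_le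
    exact ⟨C, fun n => hC _ ⟨n, rfl⟩⟩
  refine banach_steinhaus fun x => ?_
  obtain ⟨C, hC⟩ := banach_steinhaus (g := fun n => innerSL ℂ (B n x)) (fun y => hxy x y)
  exact ⟨C, fun n => by simpa using hC n⟩

/-- On a finite-dimensional space the pointwise convergence of a norm-bounded sequence of quadratic
forms is uniform on the unit sphere, so that negativity of the limit gives a uniform negative upper
bound. -/
theorem exists_eventually_re_inner_le_of_finiteDimensional {B : ℕ → H →L[ℂ] H} {b : H → ℂ} {C : ℝ}
    (hC : ∀ n, ‖B n‖ ≤ C) (h : ∀ x, Tendsto (fun n => inner ℂ (B n x) x) atTop (𝓝 (b x)))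
    (K : Submodule ℂ H) [FiniteDimensional ℂ K] (hK : ∀ z ∈ K, z ≠ 0 → (b z).re < 0) :
    ∃ c > 0, ∀ᶠ n in atTop, ∀ z ∈ K, (inner ℂ (B n z) z).re ≤ -c * ‖z‖ ^ 2 := by
  have hC0 : 0 ≤ C := (norm_nonneg _).trans (hC 0)
  let s : Set H := (fun z : K => (z : H)) '' Metric.sphere 0 1
  have hs : IsCompact s := (isCompact_sphere (0 : K) 1).image continuous_subtype_val
  have hs' : ∀ z ∈ s, z ∈ K ∧ ‖z‖ = 1 := by
    rintro _ ⟨z, hz, rfl⟩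
    exact ⟨z.2, by simpa using hz⟩
  have key : ∃ c > 0, ∀ᶠ n in atTop, ∀ z ∈ s, (inner ℂ (B n z) z).re ≤ -c := by
    refine hs.induction_on (p := fun t => ∃ c > 0, ∀ᶠ n in atTop, ∀ z ∈ t,
      (inner ℂ (B n z) z).re ≤ -c) ⟨1, one_pos, by simp⟩ ?_ ?_ ?_
    · rintro t t' htt' ⟨c, hc, hn⟩
      exact ⟨c, hc, hn.mono fun n hn z hz => hn z (htt' hz)⟩
    · rintro t t' ⟨c, hc, hn⟩ ⟨c', hc', hn'⟩
      refine ⟨min c c', lt_min hc hc', ?_⟩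
      filter_upwards [hn, hn'] with n h1 h2 z hz
      rcases hz with hz | hz
      · exact (h1 z hz).trans (neg_le_neg (min_le_left _ _))
      · exact (h2 z hz).trans (neg_le_neg (min_le_right _ _))
    · intro z₀ hz₀
      obtain ⟨hz₀K, hz₀1⟩ := hs' z₀ hz₀
      have hz₀0 : z₀ ≠ 0 := by rintro rfl; simp at hz₀1
      have hneg := hK z₀ hz₀K hz₀0
      set c := -(b z₀).re / 3 with hcdef
      have hc : 0 < c := by rw [hcdef]; linarith
      have hlim : ∀ᶠ n in atTop, (inner ℂ (B n z₀) z₀).re < -2 * c :=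
        ((Complex.continuous_re.tendsto _).comp (h z₀)).eventually_lt_const
          (by rw [hcdef]; linarith)
      refine ⟨s ∩ Metric.ball z₀ (c / (2 * C + 1)),
        inter_mem_nhdsWithin _ (Metric.ball_mem_nhds _ (by positivity)), c, hc, ?_⟩
      filter_upwards [hlim] with n hn z hz
      have hz1 := (hs' z hz.1).2
      have hd : ‖z - z₀‖ < c / (2 * C + 1) := by simpa [dist_eq_norm] using hz.2
      rw [lt_div_iff₀ (by positivity)] at hd
      have e : inner ℂ (B n z) z = inner ℂ (B n z₀) z₀ + inner ℂ (B n (z - z₀)) z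
          + inner ℂ (B n z₀) (z - z₀) := by
        simp only [map_sub, inner_sub_left, inner_sub_right]; ring
      have h1 : (inner ℂ (B n (z - z₀)) z).re ≤ C * ‖z - z₀‖ := by
        refine (Complex.re_le_norm _).trans ((norm_inner_le_norm _ _).trans ?_)
        rw [hz1, mul_one]
        exact (B n).le_of_opNorm_le (hC n) _
      have h2 : (inner ℂ (B n z₀) (z - z₀)).re ≤ C * ‖z - z₀‖ := by
        refine (Complex.re_le_norm _).trans ((norm_inner_le_norm _ _).trans ?_)
        refine mul_le_mul_of_nonneg_right ?_ (norm_nonneg _)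
        simpa [hz₀1] using (B n).le_of_opNorm_le (hC n) z₀
      rw [e, Complex.add_re, Complex.add_re]
      nlinarith [norm_nonneg (z - z₀)]
  obtain ⟨c, hc, hn⟩ := key
  refine ⟨c, hc, hn.mono fun n hn z hz => ?_⟩
  by_cases hz0 : z = 0
  · simp [hz0]
  have hzn : 0 < ‖z‖ := norm_pos_iff.2 hz0
  have h1 := hn (((‖z‖⁻¹ : ℝ) : ℂ) • z) ⟨⟨_, K.smul_mem _ hz⟩, by
    simp [norm_smul, hzn.ne'], rfl⟩
  rw [map_smul, inner_smul_left, inner_smul_right, Complex.conj_ofReal, Complex.re_ofReal_mul,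
    Complex.re_ofReal_mul, ← mul_assoc] at h1
  have h2 := mul_le_mul_of_nonneg_right h1 (sq_nonneg ‖z‖)
  have h3 : ‖z‖⁻¹ * ‖z‖⁻¹ * (inner ℂ (B n z) z).re * ‖z‖ ^ 2 = (inner ℂ (B n z) z).re := by
    field_simp
  rwa [h3] at h2

/-- A form that is definite on `W` modulo the null space `K` becomes positive definite on `K + W`
after subtraction of a small multiple of a bounded form that is negative definite on `K`. -/
theorem re_inner_sub_smul_pos {A B : H →L[ℂ] H} {K W : Submodule ℂ H} {c c' C d : ℝ} (hc' : 0 < c')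
    (hA : ∀ z ∈ K, ∀ w ∈ W, c * ‖w‖ ^ 2 ≤ (inner ℂ (A (z + w)) (z + w)).re)
    (hB : ‖B‖ ≤ C) (hBK : ∀ z ∈ K, (inner ℂ (B z) z).re ≤ -c' * ‖z‖ ^ 2)
    (hd : 0 < d) (hdc : d * (2 * C ^ 2 / c' + C) < c) {z w : H} (hz : z ∈ K) (hw : w ∈ W)
    (hzw : z + w ≠ 0) : 0 < (inner ℂ ((A - (d : ℂ) • B) (z + w)) (z + w)).re := by
  have h1 : ∀ x y, (inner ℂ (B x) y).re ≤ C * ‖x‖ * ‖y‖ := fun x y =>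
    (Complex.re_le_norm _).trans ((norm_inner_le_norm _ _).trans
      (mul_le_mul_of_nonneg_right (B.le_of_opNorm_le hB x) (norm_nonneg _)))
  have e : (inner ℂ ((A - (d : ℂ) • B) (z + w)) (z + w)).re =
      (inner ℂ (A (z + w)) (z + w)).re - d * ((inner ℂ (B z) z).re + (inner ℂ (B z) w).re +
        (inner ℂ (B w) z).re + (inner ℂ (B w) w).re) := by
    simp only [sub_apply, smul_apply, inner_sub_left,
      inner_smul_left, Complex.conj_ofReal, Complex.sub_re, Complex.re_ofReal_mul, map_add,
      inner_add_left, inner_add_right, Complex.add_re]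
    ring
  -- the cross terms are split so that half of the definiteness on `K` survives
  have h2 : 2 * C * ‖z‖ * ‖w‖ ≤ c' / 2 * ‖z‖ ^ 2 + 2 * C ^ 2 / c' * ‖w‖ ^ 2 := by
    have : 0 ≤ (c' * ‖z‖ - 2 * C * ‖w‖) ^ 2 / (2 * c') := by positivity
    have e2 : (c' * ‖z‖ - 2 * C * ‖w‖) ^ 2 / (2 * c') =
      c' / 2 * ‖z‖ ^ 2 + 2 * C ^ 2 / c' * ‖w‖ ^ 2 - 2 * C * ‖z‖ * ‖w‖ := by
      field_simp
      ring
    linarith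
  have h3 : (inner ℂ (B z) z).re + (inner ℂ (B z) w).re + (inner ℂ (B w) z).re +
      (inner ℂ (B w) w).re ≤ -(c' / 2) * ‖z‖ ^ 2 + (2 * C ^ 2 / c' + C) * ‖w‖ ^ 2 := by
    nlinarith [hBK z hz, h1 z w, h1 w z, h1 w w]
  have h4 : d * (-(c' / 2) * ‖z‖ ^ 2 + (2 * C ^ 2 / c' + C) * ‖w‖ ^ 2) < c * ‖w‖ ^ 2 := by
    by_cases hw0 : w = 0
    · have hz0 : z ≠ 0 := by rintro rfl; simp [hw0] at hzw
      have := norm_pos_iff.2 hz0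
      have : 0 < d * (c' / 2) * ‖z‖ ^ 2 := by positivity
      simp only [hw0, norm_zero]
      nlinarith
    · have := norm_pos_iff.2 hw0
      have : 0 < ‖w‖ ^ 2 := by positivity
      have : 0 ≤ d * (c' / 2) * ‖z‖ ^ 2 := by positivity
      nlinarith
  rw [e]
  have := mul_le_mul_of_nonneg_left h3 hd.le
  linarith [hA z hz w hw]

/-- Let the quadratic forms of `G t` have difference quotients at `s` that converge pointwise to `b`
along `l`. If `η G s` is nonnegative on `K + W` and definite on `W` modulo `K`, and the derivative
`b` moves `η G` upwards on `K` when `t` leaves `s` along `l`, then `η G t` is positive definite on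
`K + W` for `t` near `s`. The signs `κ` and `η` select the side of `s` and the sign of the form; for
`K = ⊥` no condition on `b` is left. -/
theorem eventually_re_inner_pos_of_tendsto_slope [CompleteSpace H] {G : ℝ → H →L[ℂ] H} {s : ℝ}
    {b : H → ℂ} {l : Filter ℝ} [l.IsCountablyGenerated] (hl : l ≤ 𝓝 s) {η κ : ℝ} (hκ : κ * κ = 1)
    (hlκ : ∀ᶠ t in l, 0 < κ * (t - s))
    (hb : ∀ x, Tendsto (fun t => ((t - s : ℝ) : ℂ)⁻¹ * (inner ℂ (G t x) x - inner ℂ (G s x) x))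
      l (𝓝 (b x)))
    {K W : Submodule ℂ H} [FiniteDimensional ℂ K] {c : ℝ} (hc : 0 < c)
    (hG : ∀ z ∈ K, ∀ w ∈ W, c * ‖w‖ ^ 2 ≤ η * (inner ℂ (G s (z + w)) (z + w)).re)
    (hK : ∀ z ∈ K, z ≠ 0 → 0 < η * κ * (b z).re) :
    ∀ᶠ t in l, ∀ z ∈ K, ∀ w ∈ W, z + w ≠ 0 → 0 < η * (inner ℂ (G t (z + w)) (z + w)).re := by
  -- along sequences, because pointwise convergence bounds only sequences pointwise
  rw [eventually_iff_seq_eventually]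
  intro u hu
  let d : ℕ → ℝ := fun n => κ * (u n - s)
  have hd : Tendsto d atTop (𝓝 0) := by
    have : Tendsto (fun n => κ * (u n - s)) atTop (𝓝 (κ * (s - s))) :=
      ((hu.mono_right hl).sub_const s).const_mul κ
    simpa using this
  -- `η G (u n) = η G s - d n • B n`
  let Q : ℕ → H →L[ℂ] H := fun n => ((u n - s : ℝ) : ℂ)⁻¹ • (G (u n) - G s)
  let B : ℕ → H →L[ℂ] H := fun n => ((-(η * κ) : ℝ) : ℂ) • Q n
  have hQ : ∀ x, Tendsto (fun n => inner ℂ (B n x) x) atTop (𝓝 (((-(η * κ) : ℝ) : ℂ) * b x)) := by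
    intro x
    refine (((hb x).comp hu).const_mul _).congr fun n => ?_
    have hcast : ((u n - s : ℝ) : ℂ)⁻¹ = (((u n - s)⁻¹ : ℝ) : ℂ) := by push_cast; rfl
    simp only [B, Q, hcast, smul_apply, inner_smul_left, Complex.conj_ofReal,
      sub_apply, inner_sub_left, Function.comp]
  obtain ⟨C, hC⟩ := exists_norm_le_of_tendsto_inner_self hQ
  obtain ⟨c', hc', hn⟩ := exists_eventually_re_inner_le_of_finiteDimensional hC hQ K (by
    intro z hz hz0
    rw [Complex.re_ofReal_mul]
    linarith [hK z hz hz0])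
  have hsmall : ∀ᶠ n in atTop, d n * (2 * C ^ 2 / c' + C) < c := by
    have := hd.mul_const (2 * C ^ 2 / c' + C)
    rw [zero_mul] at this
    exact this.eventually_lt_const hc
  filter_upwards [hn, hsmall, hu.eventually hlκ] with n h1 h2 h3 z hz w hw hzw
  have h4 := re_inner_sub_smul_pos (A := (η : ℂ) • G s) hc' (K := K) (W := W) (c := c) (by
    intro z hz w hw
    rw [smul_apply, inner_smul_left, Complex.conj_ofReal,
      Complex.re_ofReal_mul]
    exact hG z hz w hw) (hC n) h1 h3 h2 hz hw hzw
  have hne : u n - s ≠ 0 := by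
    intro h0
    simp [h0] at h3
  have e : (η : ℂ) • G s - ((κ * (u n - s) : ℝ) : ℂ) • B n = (η : ℂ) • G (u n) := by
    have hne' : ((u n - s : ℝ) : ℂ) ≠ 0 := by exact_mod_cast hne
    have hκ' : (κ : ℂ) * κ = 1 := by exact_mod_cast hκ
    simp only [B, Q, smul_smul]
    have : ((κ * (u n - s) : ℝ) : ℂ) * ((-(η * κ) : ℝ) : ℂ) * ((u n - s : ℝ) : ℂ)⁻¹ = -η := by
      rw [Complex.ofReal_mul κ]
      push_cast at hne' ⊢
      field_simp
      linear_combination (-(η : ℂ)) * hκ'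
    rw [← mul_assoc, this]
    module
  rw [e, smul_apply, inner_smul_left, Complex.conj_ofReal,
    Complex.re_ofReal_mul] at h4
  exact h4

end Perturbation

/-! ### From one-sided jumps to a count over an interval -/

section Counting

theorem ENat.summable {ι : Type*} (f : ι → ℕ∞) : Summable f :=
  ⟨_, hasSum_of_isLUB _ isLUB_iSup⟩

theorem tsum_Ico_eq_tsum_Ico_add (m : ℝ → ℕ∞) {a x y : ℝ} (hax : a ≤ x) (hxy : x ≤ y) :
    ∑' s : Set.Ico a y, m s = ∑' s : Set.Ico a x, m s + ∑' s : Set.Ico x y, m s := by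
  rw [← Set.Ico_union_Ico_eq_Ico hax hxy]
  refine Summable.tsum_union_disjoint ?_ (ENat.summable _) (ENat.summable _)
  rw [Set.disjoint_left]
  exact fun s hs hs' => absurd hs.2 (not_lt.2 hs'.1)

/-- If `ν` is constant up to and including `s` on the left of each point `s` and jumps by `m s` to
the right of it, while `m` vanishes near `s` except at `s`, then `ν` increases over an interval by
the sum of the values of `m`. The identity at `x` and the identity at `y` are equivalent for `y`
near `x`, and the interval is connected. -/
theorem tsum_Ico_add_eq_of_eventually {ν m : ℝ → ℕ} {a b : ℝ} (hab : a ≤ b)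
    (hr : ∀ s ∈ Set.Icc a b, ∀ᶠ t in 𝓝[>] s, ν t = ν s + m s ∧ m t = 0)
    (hl : ∀ s ∈ Set.Icc a b, ∀ᶠ t in 𝓝[<] s, ν t = ν s ∧ m t = 0) :
    (∑' s : Set.Ico a b, (m s : ℕ∞)) + ν a = ν b := by
  let N : ℝ → ℕ∞ := fun x => ∑' s : Set.Ico a x, (m s : ℕ∞)
  have hNa : N a = 0 := by
    have : IsEmpty (Set.Ico a a) := by simp
    exact tsum_empty
  have key : ∀ x ∈ Set.Icc a b, ∀ᶠ y in 𝓝[Set.Icc a b] x,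
      (N x + ν a = ν x ↔ N y + ν a = ν y) := by
    intro x hx
    obtain ⟨u, hu, hxu⟩ := mem_nhdsGT_iff_exists_Ioo_subset.1 (hr x hx)
    obtain ⟨v, hv, hvx⟩ := mem_nhdsLT_iff_exists_Ioo_subset.1 (hl x hx)
    filter_upwards [self_mem_nhdsWithin, mem_nhdsWithin_of_mem_nhds (Ioo_mem_nhds hv hu)]
      with y hy hyuv
    rcases lt_trichotomy y x with hlt | rfl | hgt
    · have hN : N x = N y := by
        have h0 : ∑' s : Set.Ico y x, (m s : ℕ∞) = 0 := by
          rw [ENat.summable _ |>.tsum_eq_zero_iff]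
          rintro ⟨s, hs⟩
          have := (hvx ⟨hyuv.1.trans_le hs.1, hs.2⟩).2
          simp [this]
        simp only [N]
        rw [tsum_Ico_eq_tsum_Ico_add (fun s => (m s : ℕ∞)) hy.1 hlt.le, h0, add_zero]
      rw [hN, (hvx ⟨hyuv.1, hlt⟩).1]
    · exact Iff.rfl
    · have hN : N y = N x + m x := by
        have h0 : ∑' s : Set.Ico x y, (m s : ℕ∞) = m x := by
          refine tsum_eq_single (⟨x, le_rfl, hgt⟩ : Set.Ico x y) ?_
          rintro ⟨s, hs⟩ hne
          have hxs : x < s := lt_of_le_of_ne hs.1 fun h => hne (by simp [h])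
          have := (hxu ⟨hxs, hs.2.trans hyuv.2⟩).2
          simp [this]
        simp only [N]
        rw [tsum_Ico_eq_tsum_Ico_add (fun s => (m s : ℕ∞)) hx.1 hgt.le, h0]
      rw [hN, (hxu ⟨hgt, hyuv.2⟩).1, Nat.cast_add, add_right_comm,
        (ENat.add_left_injective_of_ne_top (ENat.natCast_ne_top (m x))).eq_iff]
  have := isPreconnected_Icc.induction₂' (s := Set.Icc a b)
    (fun x y => N x + ν a = ν x → N y + ν a = ν y)
    (fun x hx => (key x hx).mono fun y h => ⟨h.1, h.2⟩) (fun x y z _ _ _ h1 h2 h => h2 (h1 h))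
    (Set.left_mem_Icc.2 hab) (Set.right_mem_Icc.2 hab)
  exact this (by rw [hNa, zero_add])

end Counting

/-! ### The resolvent of a semibounded self-adjoint operator -/

section Resolvent

variable {H : Type*} [NormedAddCommGroup H] [InnerProductSpace ℂ H]

/-- If one resolvent of `A` is compact, then `A` has a compact resolvent at every point that is
not an eigenvalue: `(A - w)⁻¹ = (1 - (w - z) R)⁻¹ R` for `R = (A - z)⁻¹`, where the inverse exists
by the Fredholm alternative. -/
theorem IsResolventOf.exists_of_isCompactOperator [CompleteSpace H] {A : H →ₗ.[ℂ] H} {z w : ℂ}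
    {R : H →L[ℂ] H} (hR : IsResolventOf A z R) (hc : IsCompactOperator R)
    (hw : ∀ x : A.domain, A x = w • (x : H) → x = 0) :
    ∃ R' : H →L[ℂ] H, IsResolventOf A w R' ∧ IsCompactOperator R' := by
  have hunit : IsUnit (1 - (w - z) • R) := by
    by_cases hk : w - z = 0
    · simp [hk]
    rcases hc.hasEigenvalue_or_mem_resolventSet (inv_ne_zero hk) with h | h
    · obtain ⟨x, hx⟩ := h.exists_hasEigenvector
      have hx1 : R x = (w - z)⁻¹ • x := hx.apply_eq_smul
      obtain ⟨hxA, hx2⟩ := (hR x ((w - z) • x)).2 (by rw [map_smul, hx1, smul_inv_smul₀ hk])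
      refine absurd (congrArg Subtype.val (hw ⟨x, hxA⟩ ?_)) hx.2
      rw [sub_eq_iff_eq_add.1 hx2]
      module
    · rw [spectrum.mem_resolventSet_iff] at h
      have h2 := h.smul (Units.mk0 _ hk)
      convert h2 using 1
      rw [Units.smul_mk0, smul_sub, Algebra.algebraMap_eq_smul_one, smul_inv_smul₀ hk]
  obtain ⟨T, hT⟩ := hunit
  refine ⟨((T⁻¹ : (H →L[ℂ] H)ˣ) : H →L[ℂ] H) ∘L R, fun x y => ?_, hc.clm_comp _⟩
  have h1 : x = (((T⁻¹ : (H →L[ℂ] H)ˣ) : H →L[ℂ] H) ∘L R) y ↔ x = R (y + (w - z) • x) := by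
    have h2 : (T : H →L[ℂ] H) x = R y ↔ x = R (y + (w - z) • x) := by
      rw [hT, map_add, map_smul]
      simp [sub_eq_iff_eq_add]
    rw [← h2]
    constructor
    · intro h
      rw [h]
      exact congrArg (fun B : H →L[ℂ] H => B (R y)) T.mul_inv
    · intro h
      rw [ContinuousLinearMap.comp_apply, ← h]
      exact (congrArg (fun B : H →L[ℂ] H => B x) T.inv_mul).symm
  rw [h1, ← hR]
  refine exists_congr fun hx => ?_
  rw [sub_eq_iff_eq_add, sub_eq_iff_eq_add]
  constructor <;> intro h <;> rw [h] <;> module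

theorem LinearPMap.inner_map_eq_of_isSelfAdjoint [CompleteSpace H] {A : H →ₗ.[ℂ] H}
    (hA : IsSelfAdjoint A)
    (x y : A.domain) : inner ℂ (A x) (y : H) = inner ℂ (x : H) (A y) := by
  have h := A.adjoint_isFormalAdjoint hA.dense_domain
  rw [LinearPMap.isSelfAdjoint_def.1 hA] at h
  exact h x y

theorem IsResolventOf.isSelfAdjoint [CompleteSpace H] {A : H →ₗ.[ℂ] H} {μ : ℝ} {R : H →L[ℂ] H}
    (hR : IsResolventOf A μ R) (hA : IsSelfAdjoint A) : IsSelfAdjoint R := by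
  rw [ContinuousLinearMap.isSelfAdjoint_iff_isSymmetric]
  intro y y'
  obtain ⟨hx, h⟩ := (hR (R y) y).2 rfl
  obtain ⟨hx', h'⟩ := (hR (R y') y').2 rfl
  have h1 := LinearPMap.inner_map_eq_of_isSelfAdjoint hA ⟨R y, hx⟩ ⟨R y', hx'⟩
  change inner ℂ (R y) y' = inner ℂ y (R y')
  nth_rw 1 [← h']
  nth_rw 2 [← h]
  simp only [inner_sub_left, inner_sub_right, inner_smul_left, inner_smul_right,
    Complex.conj_ofReal]
  rw [h1]

theorem IsResolventOf.re_inner_nonneg {A : H →ₗ.[ℂ] H} {μ μ₀ : ℝ} {R : H →L[ℂ] H}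
    (hR : IsResolventOf A μ R) (hμ : μ ≤ μ₀)
    (hA : ∀ y : A.domain, μ₀ * ‖(y : H)‖ ^ 2 ≤ (inner ℂ (A y) (y : H)).re) (y : H) :
    0 ≤ (inner ℂ (R y) y).re := by
  obtain ⟨hx, h⟩ := (hR (R y) y).2 rfl
  have h1 := hA ⟨R y, hx⟩
  have h2 : (inner ℂ y (R y)).re =
      (inner ℂ (A ⟨R y, hx⟩) (R y)).re - μ * ‖R y‖ ^ 2 := by
    nth_rw 1 [← h]
    rw [inner_sub_left, inner_smul_left, Complex.conj_ofReal, Complex.sub_re,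
      Complex.re_ofReal_mul, inner_self_eq_norm_sq_to_K]
    simp [← Complex.ofReal_pow]
  have h3 : (inner ℂ (R y) y).re = (inner ℂ y (R y)).re := inner_re_symm (𝕜 := ℂ) _ _
  rw [h3, h2]
  simp only at h1
  nlinarith [sq_nonneg ‖R y‖]

theorem IsResolventOf.injective {A : H →ₗ.[ℂ] H} {z : ℂ} {R : H →L[ℂ] H}
    (hR : IsResolventOf A z R) : Function.Injective R := by
  rw [injective_iff_map_eq_zero]
  intro y hy
  obtain ⟨hx, h⟩ := (hR 0 y).2 hy.symm
  have : (⟨0, hx⟩ : A.domain) = 0 := rfl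
  rw [this, A.map_zero, smul_zero, sub_zero] at h
  exact h.symm

/-- A positive operator has a self-adjoint square root. -/
theorem exists_isSelfAdjoint_comp_self_eq [CompleteSpace H] {R : H →L[ℂ] H}
    (hR : IsSelfAdjoint R) (hpos : ∀ x, 0 ≤ (inner ℂ (R x) x).re) :
    ∃ S : H →L[ℂ] H, IsSelfAdjoint S ∧ ∀ x, S (S x) = R x := by
  have h0 : 0 ≤ R := by
    rw [ContinuousLinearMap.nonneg_iff_isPositive, ContinuousLinearMap.isPositive_def']
    exact ⟨hR, hpos⟩
  refine ⟨CFC.sqrt R, ((ContinuousLinearMap.nonneg_iff_isPositive _).1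
    (CFC.sqrt_nonneg R)).isSelfAdjoint, fun x => ?_⟩
  exact congrArg (fun B : H →L[ℂ] H => B x) (CFC.sqrt_mul_sqrt_self R h0)

end Resolvent

/-! ### The form closure as the range of the square root of the resolvent -/

section FormClosure

variable {H : Type*} [NormedAddCommGroup H] [InnerProductSpace ℂ H]

/-- The map `x ↦ S (A x - μ x)` on `dom A`. When `S` is a square root of `(A - μ)⁻¹`, this is
`(A - μ)^{1/2}` restricted to `dom A`. -/
noncomputable def formRoot (A : H →ₗ.[ℂ] H) (μ : ℝ) (S : H →L[ℂ] H) : A.domain →ₗ[ℂ] H :=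
  S.toLinearMap ∘ₗ (A.toFun - (μ : ℂ) • A.domain.subtype)

variable {A : H →ₗ.[ℂ] H} {μ : ℝ} {R S : H →L[ℂ] H}

theorem formRoot_apply (x : A.domain) : formRoot A μ S x = S (A x - (μ : ℂ) • (x : H)) := rfl

theorem apply_formRoot (hR : IsResolventOf A μ R) (hSS : ∀ x, S (S x) = R x) (x : A.domain) :
    S (formRoot A μ S x) = x := by
  rw [formRoot_apply, hSS]
  exact ((hR x _).1 ⟨x.2, rfl⟩).symm

/-- The form of `A` is `‖(A - μ)^{1/2} x‖² + μ ‖x‖²`. -/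
theorem inner_map_self_eq_formRoot [CompleteSpace H] (hR : IsResolventOf A μ R)
    (hS : IsSelfAdjoint S) (hSS : ∀ x, S (S x) = R x) (x : A.domain) :
    inner ℂ (A x) (x : H) = ((‖formRoot A μ S x‖ ^ 2 + μ * ‖(x : H)‖ ^ 2 : ℝ) : ℂ) := by
  have h1 : A x = (A x - (μ : ℂ) • (x : H)) + (μ : ℂ) • (x : H) := by abel
  have h2 : inner ℂ (A x - (μ : ℂ) • (x : H)) (x : H) = (‖formRoot A μ S x‖ : ℂ) ^ 2 := by
    nth_rw 2 [← apply_formRoot hR hSS x]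
    have h3 := hS.isSymmetric (A x - (μ : ℂ) • (x : H)) (formRoot A μ S x)
    refine h3.symm.trans ?_
    exact inner_self_eq_norm_sq_to_K (𝕜 := ℂ) (formRoot A μ S x)
  rw [h1, inner_add_left, h2, inner_smul_left, Complex.conj_ofReal, inner_self_eq_norm_sq_to_K]
  push_cast
  rfl

theorem formConverges_of_tendsto_formRoot [CompleteSpace H] (hR : IsResolventOf A μ R)
    (hS : IsSelfAdjoint S) (hSS : ∀ x, S (S x) = R x) {u : ℕ → A.domain} {z : H}
    (hu : Tendsto (fun n => formRoot A μ S (u n)) atTop (𝓝 z)) : FormConverges A u (S z) := by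
  have h1 : Tendsto (fun n => (u n : H)) atTop (𝓝 (S z)) :=
    ((S.continuous.tendsto z).comp hu).congr fun n => apply_formRoot hR hSS (u n)
  refine ⟨h1, ?_⟩
  have h2 : ∀ {v : ℕ → H} {y : H}, Tendsto v atTop (𝓝 y) →
      Tendsto (fun n : ℕ × ℕ => ‖v n.1 - v n.2‖ ^ 2) atTop (𝓝 0) := by
    intro v y hv
    rw [← prod_atTop_atTop_eq]
    have := (((hv.comp tendsto_fst).sub (hv.comp tendsto_snd)).norm).pow 2
      (l := (atTop : Filter ℕ) ×ˢ (atTop : Filter ℕ))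
    simpa using this
  have h3 := (h2 hu).add ((h2 h1).const_mul μ)
  rw [mul_zero, add_zero] at h3
  refine ((Complex.continuous_ofReal.tendsto 0).comp h3).congr fun n => ?_
  rw [inner_map_self_eq_formRoot hR hS hSS]
  simp [map_sub]

/-- Convergence in the sense of the form of `A` is convergence of the images under
`(A - μ)^{1/2}`; the converse is `formConverges_of_tendsto_formRoot`. -/
theorem FormConverges.exists_tendsto_formRoot [CompleteSpace H] (hR : IsResolventOf A μ R)
    (hS : IsSelfAdjoint S) (hSS : ∀ x, S (S x) = R x) {u : ℕ → A.domain} {y : H}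
    (hu : FormConverges A u y) :
    ∃ z, Tendsto (fun n => formRoot A μ S (u n)) atTop (𝓝 z) ∧ S z = y := by
  have h1 : Tendsto (fun n : ℕ × ℕ => ‖(u n.1 : H) - u n.2‖ ^ 2) atTop (𝓝 0) := by
    rw [← prod_atTop_atTop_eq]
    have := (((hu.1.comp tendsto_fst).sub (hu.1.comp tendsto_snd)).norm).pow 2
      (l := (atTop : Filter ℕ) ×ˢ (atTop : Filter ℕ))
    simpa using this
  have h2 := ((Complex.continuous_re.tendsto 0).comp hu.2).sub (h1.const_mul μ)
  rw [Complex.zero_re, mul_zero, sub_zero] at h2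
  have h3 : Tendsto (fun n : ℕ × ℕ => ‖formRoot A μ S (u n.1) - formRoot A μ S (u n.2)‖ ^ 2)
      atTop (𝓝 0) := by
    refine h2.congr fun n => ?_
    rw [Function.comp, inner_map_self_eq_formRoot hR hS hSS, Complex.ofReal_re]
    simp [map_sub]
  have h4 : CauchySeq fun n => formRoot A μ S (u n) := by
    rw [cauchySeq_iff_tendsto_dist_atTop_0]
    have := (Real.continuous_sqrt.tendsto 0).comp h3
    rw [Real.sqrt_zero] at this
    refine this.congr fun n => ?_
    rw [Function.comp, Real.sqrt_sq (norm_nonneg _), dist_eq_norm]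
  obtain ⟨z, hz⟩ := cauchySeq_tendsto_of_complete h4
  refine ⟨z, hz, tendsto_nhds_unique ?_ hu.1⟩
  exact ((S.continuous.tendsto z).comp hz).congr fun n => apply_formRoot hR hSS (u n)

/-- The range of `(A - μ)^{1/2}` on `dom A` is dense: it is the range of the injective self-adjoint
operator `S`. -/
theorem exists_tendsto_formRoot [CompleteSpace H] (hR : IsResolventOf A μ R)
    (hS : IsSelfAdjoint S) (hSS : ∀ x, S (S x) = R x) (z : H) :
    ∃ u : ℕ → A.domain, Tendsto (fun n => formRoot A μ S (u n)) atTop (𝓝 z) := by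
  have hker : S.ker = ⊥ := by
    rw [LinearMap.ker_eq_bot']
    intro x hx
    have hx : S x = 0 := hx
    refine hR.injective ?_
    rw [← hSS, hx, map_zero, map_zero]
  have hdense : DenseRange S := by
    have h1 : S.rangeᗮ = ⊥ := by
      rw [ContinuousLinearMap.orthogonal_range, hS.adjoint_eq, hker]
    exact (Submodule.dense_iff_topologicalClosure_eq_top).2
      (Submodule.topologicalClosure_eq_top_iff.2 h1)
  obtain ⟨v, hv, hvz⟩ := mem_closure_iff_seq_limit.1 (hdense z)
  choose y hy using hv
  refine ⟨fun n => ⟨R (y n), ((hR _ (y n)).2 rfl).choose⟩, hvz.congr fun n => ?_⟩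
  rw [formRoot_apply, ((hR _ (y n)).2 rfl).choose_spec, hy]

/-- The form domain of `A` is the range of `S = (A - μ)^{-1/2}`. -/
theorem IsFormClosure.mem_iff_mem_range [CompleteSpace H] {D : Submodule ℂ H}
    {f : D →ₗ⋆[ℂ] D →ₗ[ℂ] ℂ} (hf : IsFormClosure A D f) (hR : IsResolventOf A μ R)
    (hS : IsSelfAdjoint S) (hSS : ∀ x, S (S x) = R x) (y : H) : y ∈ D ↔ ∃ z, S z = y := by
  rw [hf.mem_iff]
  constructor
  · rintro ⟨u, hu⟩
    obtain ⟨z, -, hz⟩ := hu.exists_tendsto_formRoot hR hS hSS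
    exact ⟨z, hz⟩
  · rintro ⟨z, rfl⟩
    obtain ⟨u, hu⟩ := exists_tendsto_formRoot hR hS hSS z
    exact ⟨u, formConverges_of_tendsto_formRoot hR hS hSS hu⟩

/-- In the coordinates `z ↦ S z` on the form domain, the closed form of `A` is the form of the
bounded operator `1 + μ (A - μ)⁻¹`. -/
theorem IsFormClosure.apply_self_eq [CompleteSpace H] {D : Submodule ℂ H}
    {f : D →ₗ⋆[ℂ] D →ₗ[ℂ] ℂ} (hf : IsFormClosure A D f) (hR : IsResolventOf A μ R)
    (hS : IsSelfAdjoint S) (hSS : ∀ x, S (S x) = R x) (z : H) (y : D) (hy : (y : H) = S z) :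
    f y y = inner ℂ (((1 : H →L[ℂ] H) + (μ : ℂ) • R) z) z := by
  obtain ⟨u, hu⟩ := exists_tendsto_formRoot hR hS hSS z
  have hconv := formConverges_of_tendsto_formRoot hR hS hSS hu
  rw [← hy] at hconv
  refine tendsto_nhds_unique (hf.tendsto u y hconv) ?_
  have h1 : Tendsto (fun n => ‖formRoot A μ S (u n)‖ ^ 2 + μ * ‖(u n : H)‖ ^ 2) atTop
      (𝓝 (‖z‖ ^ 2 + μ * ‖(y : H)‖ ^ 2)) := (hu.norm.pow 2).add ((hconv.1.norm.pow 2).const_mul μ)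
  have h2 : inner ℂ (((1 : H →L[ℂ] H) + (μ : ℂ) • R) z) z =
      ((‖z‖ ^ 2 + μ * ‖(y : H)‖ ^ 2 : ℝ) : ℂ) := by
    have h3 : inner ℂ (R z) z = (‖S z‖ : ℂ) ^ 2 := by
      rw [← hSS]
      exact (hS.isSymmetric (S z) z).trans (inner_self_eq_norm_sq_to_K (𝕜 := ℂ) (S z))
    rw [add_apply, inner_add_left, smul_apply, inner_smul_left, h3, hy,
      Complex.conj_ofReal, one_apply_eq_self, inner_self_eq_norm_sq_to_K]
    push_cast
    rfl
  rw [h2]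
  refine ((Complex.continuous_ofReal.tendsto _).comp h1).congr fun n => ?_
  rw [Function.comp, inner_map_self_eq_formRoot hR hS hSS]

end FormClosure

/-! ### Eigenspaces of an operator and of its resolvent -/

section Eigenspaces

variable {H : Type*} [NormedAddCommGroup H] [InnerProductSpace ℂ H]

/-- The eigenspace of the unbounded operator `A` at the real number `t`, as a subspace of `H`. -/
def ambientEigenspace (A : H →ₗ.[ℂ] H) (t : ℝ) : Submodule ℂ H :=
  (unboundedEigenspace A t).map A.domain.subtype

theorem mem_ambientEigenspace {A : H →ₗ.[ℂ] H} {t : ℝ} {x : H} :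
    x ∈ ambientEigenspace A t ↔ ∃ hx : x ∈ A.domain, A ⟨x, hx⟩ = (t : ℂ) • x := by
  constructor
  · rintro ⟨y, hy, rfl⟩
    exact ⟨y.2, sub_eq_zero.1 hy⟩
  · rintro ⟨hx, h⟩
    exact ⟨⟨x, hx⟩, sub_eq_zero.2 h, rfl⟩

theorem eigenMultiplicity_eq_toENat_rank (A : H →ₗ.[ℂ] H) (t : ℝ) :
    eigenMultiplicity A t = Cardinal.toENat (Module.rank ℂ (ambientEigenspace A t)) := by
  rw [eigenMultiplicity, ambientEigenspace, (Submodule.equivMapOfInjective A.domain.subtype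
    Subtype.val_injective (unboundedEigenspace A t)).rank_eq]

theorem IsResolventOf.mem_ambientEigenspace_iff {A : H →ₗ.[ℂ] H} {μ : ℝ} {R : H →L[ℂ] H}
    (hR : IsResolventOf A μ R) {t : ℝ} {x : H} :
    x ∈ ambientEigenspace A t ↔ R x = (((t - μ)⁻¹ : ℝ) : ℂ) • x := by
  have h1 : x ∈ ambientEigenspace A t ↔ x = R (((t - μ : ℝ) : ℂ) • x) := by
    rw [mem_ambientEigenspace, ← hR]
    refine exists_congr fun hx => ?_
    rw [sub_eq_iff_eq_add, Complex.ofReal_sub, sub_smul, sub_add_cancel]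
  rw [h1, map_smul]
  by_cases ht : t - μ = 0
  · -- `t = μ` is not an eigenvalue of `A`, and `0⁻¹ = 0` is not an eigenvalue of `R`
    simp only [ht, inv_zero, Complex.ofReal_zero, zero_smul]
    constructor
    · rintro rfl
      simp
    · intro h
      exact hR.injective (h.trans (map_zero R).symm)
  · have ht' : ((t - μ : ℝ) : ℂ) ≠ 0 := by exact_mod_cast ht
    rw [Complex.ofReal_inv, eq_inv_smul_iff₀ ht', eq_comm]

theorem IsResolventOf.ambientEigenspace_eq {A : H →ₗ.[ℂ] H} {μ : ℝ} {R : H →L[ℂ] H}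
    (hR : IsResolventOf A μ R) (t : ℝ) :
    ambientEigenspace A t = Module.End.eigenspace (R : H →ₗ[ℂ] H) (((t - μ)⁻¹ : ℝ) : ℂ) := by
  ext x
  rw [hR.mem_ambientEigenspace_iff, Module.End.mem_eigenspace_iff]
  rfl

theorem IsResolventOf.iSupIndep_ambientEigenspace {A : H →ₗ.[ℂ] H} {μ : ℝ} {R : H →L[ℂ] H}
    (hR : IsResolventOf A μ R) : iSupIndep (ambientEigenspace A) := by
  have h := (Module.End.eigenspaces_iSupIndep (R : H →ₗ[ℂ] H)).comp
    (f := fun t : ℝ => (((t - μ)⁻¹ : ℝ) : ℂ)) (fun t t' h => by simpa using h)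
  exact (funext fun t => hR.ambientEigenspace_eq t) ▸ h

theorem inner_eq_zero_of_mem_ambientEigenspace [CompleteSpace H] {A : H →ₗ.[ℂ] H}
    (hA : IsSelfAdjoint A) {s t : ℝ} (hst : s ≠ t) {x y : H} (hx : x ∈ ambientEigenspace A s)
    (hy : y ∈ ambientEigenspace A t) : inner ℂ x y = 0 := by
  obtain ⟨hx, hx'⟩ := mem_ambientEigenspace.1 hx
  obtain ⟨hy, hy'⟩ := mem_ambientEigenspace.1 hy
  have h := LinearPMap.inner_map_eq_of_isSelfAdjoint hA ⟨x, hx⟩ ⟨y, hy⟩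
  rw [hx', hy', inner_smul_left, inner_smul_right, Complex.conj_ofReal] at h
  have h2 : ((s : ℂ) - t) * inner ℂ x y = 0 := by linear_combination h
  exact (mul_eq_zero.1 h2).resolve_left (sub_ne_zero.2 (by exact_mod_cast hst))

theorem le_of_mem_ambientEigenspace {A : H →ₗ.[ℂ] H} {μ t : ℝ}
    (hA : ∀ y : A.domain, μ * ‖(y : H)‖ ^ 2 ≤ (inner ℂ (A y) (y : H)).re)
    {x : H} (hx : x ∈ ambientEigenspace A t) (hx0 : x ≠ 0) : μ ≤ t := by
  obtain ⟨hx, hx'⟩ := mem_ambientEigenspace.1 hx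
  have h := hA ⟨x, hx⟩
  rw [hx', inner_smul_left, Complex.conj_ofReal, inner_self_eq_norm_sq_to_K,
    Complex.re_ofReal_mul] at h
  have h1 : 0 < ‖x‖ ^ 2 := by positivity
  have h2 : μ * ‖x‖ ^ 2 ≤ t * ‖x‖ ^ 2 := by simpa [← Complex.ofReal_pow] using h
  exact le_of_mul_le_mul_right h2 h1

end Eigenspaces

/-! ### Splitting of the form domain -/

/-- A splitting of the form domain `D` of an operator `A`, with respect to the quadratic form `q`
on `D`, into a negative, a null and a positive part. The space `D` is parametrized by a linear
bijection `e` from the Hilbert space `H` itself, and the three parts are recorded as subspaces of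
`H`. In these coordinates `q` is the quadratic form of the bounded operator `G`. -/
structure FormSplitting {H : Type*} [NormedAddCommGroup H] [InnerProductSpace ℂ H]
    (A : H →ₗ.[ℂ] H) (D : Submodule ℂ H) (q : D → ℂ) where
  /-- The parametrization of the form domain. -/
  e : H ≃ₗ[ℂ] D
  continuous_e : Continuous fun x => (e x : H)
  /-- The operator of the form in the coordinates given by `e`. -/
  G : H →L[ℂ] H
  form_eq : ∀ x, q (e x) = inner ℂ (G x) x
  /-- The negative part. -/
  neg : Submodule ℂ H
  /-- The null part. -/
  ker : Submodule ℂ H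
  /-- The positive part. -/
  pos : Submodule ℂ H
  finiteDimensional_neg : FiniteDimensional ℂ neg
  finiteDimensional_ker : FiniteDimensional ℂ ker
  disjoint : Disjoint neg ker
  isCompl : IsCompl (neg ⊔ ker) pos
  /-- The constant in the definiteness of the form on the two definite parts. -/
  c : ℝ
  c_pos : 0 < c
  form_neg : ∀ z ∈ ker, ∀ w ∈ neg, (inner ℂ (G (z + w)) (z + w)).re ≤ -c * ‖w‖ ^ 2
  form_pos : ∀ z ∈ ker, ∀ w ∈ pos, c * ‖w‖ ^ 2 ≤ (inner ℂ (G (z + w)) (z + w)).re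
  negEigenvalueCount_eq : negEigenvalueCount A = Module.finrank ℂ neg
  eigenMultiplicity_eq : eigenMultiplicity A 0 = Module.finrank ℂ ker
  map_eq_zero : ∀ z ∈ ker, ∃ h : (e z : H) ∈ A.domain, A ⟨e z, h⟩ = 0

section Splitting

variable {H : Type*} [NormedAddCommGroup H] [InnerProductSpace ℂ H]

variable {A : H →ₗ.[ℂ] H} {μ μ₀ : ℝ} {R : H →L[ℂ] H}

/-- The span of the eigenspaces of `A` at the negative numbers. -/
def negativeSpace (A : H →ₗ.[ℂ] H) : Submodule ℂ H := ⨆ t : Set.Iio (0 : ℝ), ambientEigenspace A t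

theorem inv_neg_le_of_ambientEigenspace_ne_bot
    (hA : ∀ y : A.domain, μ₀ * ‖(y : H)‖ ^ 2 ≤ (inner ℂ (A y) (y : H)).re) (hμ : μ < μ₀)
    {t : ℝ} (ht : t ≤ 0) (hE : ambientEigenspace A t ≠ ⊥) : (-μ)⁻¹ ≤ (t - μ)⁻¹ := by
  obtain ⟨x, hx, hx0⟩ := Submodule.exists_mem_ne_zero_of_ne_bot hE
  have := le_of_mem_ambientEigenspace hA hx hx0
  exact inv_anti₀ (by linarith) (by linarith)

variable [CompleteSpace H]

/-- The eigenvectors of `A` at numbers `t ≤ 0` span a finite-dimensional space, since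
`(A - μ)⁻¹ ≥ (-μ)⁻¹` on it. -/
theorem IsResolventOf.finiteDimensional_negativeSpace_sup (hR : IsResolventOf A μ R)
    (hc : IsCompactOperator R) (hsa : IsSelfAdjoint A)
    (hA : ∀ y : A.domain, μ₀ * ‖(y : H)‖ ^ 2 ≤ (inner ℂ (A y) (y : H)).re) (hμ : μ < μ₀)
    (hμ0 : μ < 0) : FiniteDimensional ℂ (negativeSpace A ⊔ ambientEigenspace A 0 :) := by
  have hfin : FiniteDimensional ℂ (⨆ t : Set.Iic (0 : ℝ), ambientEigenspace A t :) := by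
    have hr : 0 < (-μ)⁻¹ := inv_pos.2 (by linarith)
    refine finiteDimensional_of_isCompactOperator_of_le_norm hc _ hr fun x hx => ?_
    have h1 := mul_norm_sq_le_re_inner_of_mem_iSup (T := R)
      (a := fun t : Set.Iic (0 : ℝ) => (t - μ)⁻¹) (r := (-μ)⁻¹)
      (fun s t hst x hx y hy => inner_eq_zero_of_mem_ambientEigenspace hsa
        (Subtype.coe_injective.ne hst) hx hy)
      (fun t x hx => hR.mem_ambientEigenspace_iff.1 hx)
      (fun t ht => inv_neg_le_of_ambientEigenspace_ne_bot hA hμ t.2 ht) hx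
    have h2 : (inner ℂ (R x) x).re ≤ ‖R x‖ * ‖x‖ :=
      (Complex.re_le_norm _).trans (norm_inner_le_norm _ _)
    rcases (norm_nonneg x).eq_or_lt with h0 | h0
    · rw [← h0, mul_zero]
      exact norm_nonneg _
    · refine le_of_mul_le_mul_right ?_ h0
      nlinarith
  refine Submodule.finiteDimensional_of_le (sup_le (iSup_le fun t => ?_) ?_ :
    _ ≤ (⨆ t : Set.Iic (0 : ℝ), ambientEigenspace A t))
  · exact le_iSup (fun t : Set.Iic (0 : ℝ) => ambientEigenspace A t)
      ⟨t, Set.mem_Iic.2 (le_of_lt t.2)⟩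
  · exact le_iSup (fun t : Set.Iic (0 : ℝ) => ambientEigenspace A t) ⟨0, Set.mem_Iic.2 le_rfl⟩

/-- The form is uniformly negative on the span of the eigenvectors at negative numbers, because only
finitely many negative numbers are eigenvalues. -/
theorem IsResolventOf.exists_re_inner_le_of_mem_negativeSpace (hR : IsResolventOf A μ R)
    (hsa : IsSelfAdjoint A) [FiniteDimensional ℂ (negativeSpace A)]
    (hA : ∀ y : A.domain, μ₀ * ‖(y : H)‖ ^ 2 ≤ (inner ℂ (A y) (y : H)).re) (hμ : μ < μ₀) :
    ∃ c > 0, ∀ x ∈ negativeSpace A,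
      (inner ℂ (((1 : H →L[ℂ] H) + (μ : ℂ) • R) x) x).re ≤ -c * ‖x‖ ^ 2 := by
  have hind : iSupIndep fun t : Set.Iio (0 : ℝ) => ambientEigenspace A t :=
    hR.iSupIndep_ambientEigenspace.comp Subtype.coe_injective
  have : FiniteDimensional ℂ (⨆ t : Set.Iio (0 : ℝ), ambientEigenspace A t :) :=
    inferInstanceAs (FiniteDimensional ℂ (negativeSpace A))
  have hfin := finite_ne_bot_of_iSupIndep hind
  -- the eigenvalue of `-(1 + μ R)` on the eigenspace of `A` at `t`
  let a : Set.Iio (0 : ℝ) → ℝ := fun t => -(1 + μ * (t - μ)⁻¹)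
  have ha : ∀ t ∈ {t : Set.Iio (0 : ℝ) | ambientEigenspace A t ≠ ⊥}, ∀ᶠ c in 𝓝[>] 0, c ≤ a t := by
    intro t ht
    obtain ⟨x, hx, hx0⟩ := Submodule.exists_mem_ne_zero_of_ne_bot ht
    have h1 := le_of_mem_ambientEigenspace hA hx hx0
    have h2 : (t : ℝ) < 0 := t.2
    have h3 : 0 < a t := by
      have h4 : 0 < (t : ℝ) - μ := by linarith
      have : a t = -t / (t - μ) := by simp only [a]; field_simp; ring
      rw [this]
      exact div_pos (by linarith) h4
    exact mem_nhdsWithin_of_mem_nhds (Iic_mem_nhds h3)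
  obtain ⟨c, hca, hc⟩ := (((eventually_all_finite hfin).2 ha).and self_mem_nhdsWithin).exists
  refine ⟨c, hc, fun x hx => ?_⟩
  have h1 := mul_norm_sq_le_re_inner_of_mem_iSup (T := -((1 : H →L[ℂ] H) + (μ : ℂ) • R))
      (a := a) (r := c) (fun s t hst x hx y hy => inner_eq_zero_of_mem_ambientEigenspace hsa
        (Subtype.coe_injective.ne hst) hx hy) (fun t x hx => ?_) hca hx
  · rw [neg_apply, inner_neg_left, Complex.neg_re] at h1
    linarith
  · rw [neg_apply, add_apply, smul_apply, hR.mem_ambientEigenspace_iff.1 hx, one_apply_eq_self]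
    simp only [a]
    push_cast
    module

/-- The form is definite on the orthogonal complement of the eigenspaces of `A` at `t ≤ 0`: there
the compact operator `R = (A - μ)⁻¹` has only eigenvalues, hence norm, below `(-μ)⁻¹`. -/
theorem IsResolventOf.exists_le_re_inner_of_mem_orthogonal (hR : IsResolventOf A μ R)
    (hc : IsCompactOperator R) (hsa : IsSelfAdjoint A)
    (hA : ∀ y : A.domain, μ₀ * ‖(y : H)‖ ^ 2 ≤ (inner ℂ (A y) (y : H)).re) (hμ : μ < μ₀)
    (hμ0 : μ < 0) :
    ∃ c > 0, ∀ x ∈ (negativeSpace A ⊔ ambientEigenspace A 0)ᗮ,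
      c * ‖x‖ ^ 2 ≤ (inner ℂ (((1 : H →L[ℂ] H) + (μ : ℂ) • R) x) x).re := by
  have hRsa := hR.isSelfAdjoint hsa
  set V := negativeSpace A ⊔ ambientEigenspace A 0 with hV
  have hE : ∀ t ≤ 0, ambientEigenspace A t ≤ V := by
    intro t ht
    rcases ht.lt_or_eq with ht | rfl
    · exact (le_iSup (fun t : Set.Iio (0 : ℝ) => ambientEigenspace A t) ⟨t, ht⟩).trans le_sup_left
    · exact le_sup_right
  have hRE : ∀ t, ambientEigenspace A t ≤ (ambientEigenspace A t).comap (R : H →ₗ[ℂ] H) := by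
    intro t x hx
    change R x ∈ ambientEigenspace A t
    rw [hR.mem_ambientEigenspace_iff.1 hx]
    exact Submodule.smul_mem _ _ hx
  have hRV : V ≤ V.comap (R : H →ₗ[ℂ] H) := by
    refine sup_le (iSup_le fun t => ?_) ?_
    · exact (hRE t).trans (Submodule.comap_mono (hE t (le_of_lt t.2)))
    · exact (hRE 0).trans (Submodule.comap_mono (hE 0 le_rfl))
  have hRP : ∀ x ∈ Vᗮ, R x ∈ Vᗮ := by
    intro x hx v hv
    have h1 : inner ℂ (R v) x = inner ℂ v (R x) := hRsa.isSymmetric v x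
    rw [← h1]
    exact hx _ (hRV hv)
  let T : Vᗮ →L[ℂ] Vᗮ := R.restrict hRP
  have hT : ∀ x : Vᗮ, ((T x : Vᗮ) : H) = R x := fun _ => rfl
  have hr : 0 < (-μ)⁻¹ := inv_pos.2 (by linarith)
  have hTsymm : (T : Vᗮ →ₗ[ℂ] Vᗮ).IsSymmetric := hRsa.isSymmetric.restrict_invariant hRP
  have hnorm : ‖T‖ < (-μ)⁻¹ := by
    refine opNorm_lt_of_isCompactOperator_of_forall_eigenvalue_lt (hc.restrict' hRP)
      hTsymm.isSelfAdjoint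
      (fun x => hR.re_inner_nonneg hμ.le hA x) hr fun a x hx hx0 => ?_
    by_contra! ha
    -- otherwise `x` would be an eigenvector of `A` at `μ + a⁻¹ ≤ 0`
    have ht : μ + a⁻¹ ≤ 0 := by
      have := inv_anti₀ hr ha
      rw [inv_inv] at this
      linarith
    have hxE : (x : H) ∈ ambientEigenspace A (μ + a⁻¹) := by
      rw [hR.mem_ambientEigenspace_iff, add_sub_cancel_left, inv_inv]
      exact congrArg Subtype.val hx
    have h1 := x.2 _ (hE _ ht hxE)
    rw [inner_self_eq_zero] at h1
    exact hx0 (Subtype.ext h1)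
  refine ⟨1 + μ * ‖T‖, ?_, fun x hx => ?_⟩
  · rw [← one_div, lt_div_iff₀ (by linarith)] at hnorm
    linarith
  · have h1 : (inner ℂ (R x) x).re ≤ ‖T‖ * ‖x‖ * ‖x‖ := by
      refine (Complex.re_le_norm _).trans ((norm_inner_le_norm _ _).trans ?_)
      exact mul_le_mul_of_nonneg_right (T.le_opNorm ⟨x, hx⟩) (norm_nonneg x)
    have h2 : (inner ℂ (((1 : H →L[ℂ] H) + (μ : ℂ) • R) x) x).re =
        ‖x‖ ^ 2 + μ * (inner ℂ (R x) x).re := by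
      rw [add_apply, smul_apply, inner_add_left, inner_smul_left, Complex.conj_ofReal,
        Complex.add_re, Complex.re_ofReal_mul, one_apply_eq_self, inner_self_eq_norm_sq_to_K]
      simp [← Complex.ofReal_pow]
    rw [h2]
    nlinarith

/-- The splitting is into the spans of the eigenvectors of `A` at negative numbers, at `0`, and the
orthogonal complement of these. The square root `S` of the resolvent commutes with the resolvent, so
that null vectors in the coordinates `e = S` are mapped to null vectors of `A`. -/
theorem IsFormClosure.nonempty_formSplitting {D : Submodule ℂ H} {f : D →ₗ⋆[ℂ] D →ₗ[ℂ] ℂ}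
    (hf : IsFormClosure A D f) (hsa : IsSelfAdjoint A) (hcomp : HasCompactResolvent A)
    (hA : ∀ y : A.domain, μ₀ * ‖(y : H)‖ ^ 2 ≤ (inner ℂ (A y) (y : H)).re) :
    Nonempty (FormSplitting A D fun y => f y y) := by
  obtain ⟨μ, hμ, hμ0⟩ : ∃ μ : ℝ, μ < μ₀ ∧ μ < 0 :=
    ⟨min μ₀ 0 - 1, by linarith [min_le_left μ₀ 0], by linarith [min_le_right μ₀ 0]⟩
  obtain ⟨z, R₀, hR₀, hR₀c⟩ := hcomp
  obtain ⟨R, hR, hRc⟩ := hR₀.exists_of_isCompactOperator (w := (μ : ℂ)) hR₀c (by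
    intro x hx
    by_contra hx0
    have := le_of_mem_ambientEigenspace hA (mem_ambientEigenspace.2 ⟨x.2, hx⟩)
      (fun h => hx0 (Subtype.ext h))
    linarith)
  have hRsa := hR.isSelfAdjoint hsa
  obtain ⟨S, hS, hSS⟩ := exists_isSelfAdjoint_comp_self_eq hRsa (hR.re_inner_nonneg hμ.le hA)
  have hSD : ∀ x, S x ∈ D := fun x => (hf.mem_iff_mem_range hR hS hSS _).2 ⟨x, rfl⟩
  let e : H ≃ₗ[ℂ] D := LinearEquiv.ofBijective ((S : H →ₗ[ℂ] H).codRestrict D hSD) (by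
    constructor
    · intro x y hxy
      have h : S x = S y := congrArg Subtype.val hxy
      exact hR.injective (by rw [← hSS, h, hSS])
    · intro y
      obtain ⟨x, hx⟩ := (hf.mem_iff_mem_range hR hS hSS _).1 y.2
      exact ⟨x, Subtype.ext hx⟩)
  have he : ∀ x, (e x : H) = S x := fun _ => rfl
  set G : H →L[ℂ] H := 1 + (μ : ℂ) • R with hG
  have hVfin := hR.finiteDimensional_negativeSpace_sup hRc hsa hA hμ hμ0
  have hLfin : FiniteDimensional ℂ (negativeSpace A) :=
    Submodule.finiteDimensional_of_le (le_sup_left : _ ≤ negativeSpace A ⊔ ambientEigenspace A 0)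
  have hKfin : FiniteDimensional ℂ (ambientEigenspace A 0) :=
    Submodule.finiteDimensional_of_le (le_sup_right : _ ≤ negativeSpace A ⊔ ambientEigenspace A 0)
  obtain ⟨c₁, hc₁, hneg⟩ := hR.exists_re_inner_le_of_mem_negativeSpace hsa hA hμ
  obtain ⟨c₂, hc₂, hpos⟩ := hR.exists_le_re_inner_of_mem_orthogonal hRc hsa hA hμ hμ0
  have hGsa : ∀ x y, inner ℂ (G x) y = inner ℂ x (G y) := by
    intro x y
    have h1 : inner ℂ (R x) y = inner ℂ x (R y) := hRsa.isSymmetric x y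
    simp only [hG, add_apply, smul_apply, one_apply_eq_self, inner_add_left, inner_add_right,
      inner_smul_left, inner_smul_right, Complex.conj_ofReal, h1]
  have hGK : ∀ z ∈ ambientEigenspace A 0, G z = 0 := by
    intro z hz
    rw [hG, add_apply, smul_apply, one_apply_eq_self, hR.mem_ambientEigenspace_iff.1 hz, smul_smul,
      ← Complex.ofReal_mul, zero_sub, inv_neg, mul_neg, mul_inv_cancel₀ hμ0.ne]
    simp
  have hGadd : ∀ z ∈ ambientEigenspace A 0, ∀ w,
      inner ℂ (G (z + w)) (z + w) = inner ℂ (G w) w := by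
    intro z hz w
    rw [map_add, hGK z hz, zero_add, inner_add_right, hGsa w z, hGK z hz, inner_zero_right,
      zero_add]
  have hind := hR.iSupIndep_ambientEigenspace
  refine ⟨{
    e := e
    continuous_e := S.continuous
    G := G
    form_eq := fun x => hf.apply_self_eq hR hS hSS x (e x) (he x)
    neg := negativeSpace A
    ker := ambientEigenspace A 0
    pos := (negativeSpace A ⊔ ambientEigenspace A 0)ᗮ
    finiteDimensional_neg := hLfin
    finiteDimensional_ker := hKfin
    disjoint := ?_
    isCompl := Submodule.isCompl_orthogonal _
    c := min c₁ c₂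
    c_pos := lt_min hc₁ hc₂
    form_neg := ?_
    form_pos := ?_
    negEigenvalueCount_eq := ?_
    eigenMultiplicity_eq := ?_
    map_eq_zero := ?_ }⟩
  · refine (hind 0).symm.mono_left (iSup_le fun t => ?_)
    exact le_iSup₂_of_le (t : ℝ) (ne_of_lt t.2) le_rfl
  · intro z hz w hw
    rw [hGadd z hz]
    refine (hneg w hw).trans ?_
    nlinarith [min_le_left c₁ c₂, sq_nonneg ‖w‖]
  · intro z hz w hw
    rw [hGadd z hz]
    refine le_trans ?_ (hpos w hw)
    nlinarith [min_le_right c₁ c₂, sq_nonneg ‖w‖]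
  · have : FiniteDimensional ℂ (⨆ t : Set.Iio (0 : ℝ), ambientEigenspace A t :) := hLfin
    refine Eq.trans ?_ (tsum_toENat_rank_eq_finrank_iSup
      (hind.comp (Subtype.coe_injective : Function.Injective ((↑) : Set.Iio (0 : ℝ) → ℝ))))
    exact tsum_congr fun t => eigenMultiplicity_eq_toENat_rank A t
  · rw [eigenMultiplicity_eq_toENat_rank, ← Module.finrank_eq_rank, Cardinal.toENat_nat]
  · intro z hz
    have h1 : S z ∈ ambientEigenspace A 0 := by
      rw [hR.mem_ambientEigenspace_iff] at hz ⊢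
      rw [← hSS, hSS z, hz, map_smul]
    obtain ⟨h2, h3⟩ := mem_ambientEigenspace.1 h1
    exact ⟨h2, h3.trans (by simp)⟩

end Splitting

/-! ### Comparison of splittings for two operators with the same form domain -/

section Comparison

variable {H : Type*} [NormedAddCommGroup H] [InnerProductSpace ℂ H]
variable {A A₀ : H →ₗ.[ℂ] H} {D : Submodule ℂ H} {q q₀ : D → ℂ}

namespace FormSplitting

/-- In the coordinates of one splitting of `D`, every other form on `D` that has a splitting is
the form of a bounded operator: the change of coordinates is continuous by the closed graph
theorem. -/
theorem exists_form_eq_inner [CompleteSpace H] (Sp₀ : FormSplitting A₀ D q₀)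
    (Sp : FormSplitting A D q) : ∃ G : H →L[ℂ] H, ∀ x, q (Sp₀.e x) = inner ℂ (G x) x := by
  let T : H →ₗ[ℂ] H := (Sp₀.e.trans Sp.e.symm : H ≃ₗ[ℂ] H)
  have hT : ∀ x, Sp.e (T x) = Sp₀.e x := fun x => Sp.e.apply_symm_apply _
  have hcont : Continuous T := by
    refine T.continuous_of_seq_closed_graph fun u x y hu hTu => ?_
    have h1 : Tendsto (fun n => (Sp₀.e (u n) : H)) atTop (𝓝 (Sp₀.e x)) :=
      (Sp₀.continuous_e.tendsto x).comp hu
    have h2 : Tendsto (fun n => (Sp₀.e (u n) : H)) atTop (𝓝 (Sp.e y)) := by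
      refine ((Sp.continuous_e.tendsto y).comp hTu).congr fun n => ?_
      exact congrArg Subtype.val (hT (u n))
    have h3 : Sp.e y = Sp₀.e x := Subtype.ext (tendsto_nhds_unique h2 h1)
    exact Sp.e.injective (h3.trans (hT x).symm)
  let T' : H →L[ℂ] H := ⟨T, hcont⟩
  refine ⟨ContinuousLinearMap.adjoint T' ∘L Sp.G ∘L T', fun x => ?_⟩
  rw [ContinuousLinearMap.comp_apply, ContinuousLinearMap.adjoint_inner_left, ← hT, Sp.form_eq]
  rfl

theorem finrank_neg_sup_ker (Sp : FormSplitting A D q) :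
    Module.finrank ℂ (Sp.neg ⊔ Sp.ker :) =
      Module.finrank ℂ Sp.neg + Module.finrank ℂ Sp.ker := by
  have := Sp.finiteDimensional_neg
  have := Sp.finiteDimensional_ker
  have h := Submodule.finrank_sup_add_finrank_inf_eq Sp.neg Sp.ker
  rwa [Sp.disjoint.eq_bot, finrank_bot, add_zero] at h

theorem isCompl_neg (Sp : FormSplitting A D q) : IsCompl Sp.neg (Sp.ker ⊔ Sp.pos) :=
  ⟨Sp.disjoint.disjoint_sup_right_of_disjoint_sup_left Sp.isCompl.disjoint,
    codisjoint_iff.2 (by rw [← sup_assoc, Sp.isCompl.sup_eq_top])⟩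

theorem form_nonneg (Sp : FormSplitting A D q) {x : H} (hx : x ∈ Sp.ker ⊔ Sp.pos) :
    0 ≤ (q (Sp.e x)).re := by
  obtain ⟨z, hz, w, hw, rfl⟩ := Submodule.mem_sup.1 hx
  rw [Sp.form_eq]
  have := Sp.c_pos
  exact le_trans (by positivity) (Sp.form_pos z hz w hw)

theorem form_nonpos (Sp : FormSplitting A D q) {x : H} (hx : x ∈ Sp.neg ⊔ Sp.ker) :
    (q (Sp.e x)).re ≤ 0 := by
  rw [sup_comm] at hx
  obtain ⟨z, hz, w, hw, rfl⟩ := Submodule.mem_sup.1 hx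
  rw [Sp.form_eq]
  refine (Sp.form_neg z hz w hw).trans ?_
  nlinarith [Sp.c_pos, sq_nonneg ‖w‖]

/-- A subspace on which the form is negative definite has at most the dimension of the negative
part. -/
theorem finrank_le_finrank_neg (Sp : FormSplitting A D q) (e : H ≃ₗ[ℂ] D) {U : Submodule ℂ H}
    (hU : ∀ x ∈ U, x ≠ 0 → (q (e x)).re < 0) :
    Module.finrank ℂ U ≤ Module.finrank ℂ Sp.neg := by
  have := Sp.finiteDimensional_neg
  rw [← LinearEquiv.finrank_map_eq (e.trans Sp.e.symm) U]
  refine finrank_le_of_disjoint_of_isCompl Sp.isCompl_neg ?_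
  rw [Submodule.disjoint_def]
  rintro _ ⟨x, hx, rfl⟩ hx'
  by_contra h0
  have h1 := Sp.form_nonneg hx'
  have h2 := hU x hx (by rintro rfl; simp at h0)
  simp at h1
  linarith

/-- If the form is positive definite on a complement of `W`, then its nonpositive part has at most
the dimension of `W`. -/
theorem finrank_neg_add_finrank_ker_le (Sp : FormSplitting A D q) (e : H ≃ₗ[ℂ] D)
    {W Q : Submodule ℂ H} [FiniteDimensional ℂ W] (hWQ : IsCompl W Q)
    (hQ : ∀ x ∈ Q, x ≠ 0 → 0 < (q (e x)).re) :
    Module.finrank ℂ Sp.neg + Module.finrank ℂ Sp.ker ≤ Module.finrank ℂ W := by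
  rw [← Sp.finrank_neg_sup_ker, ← LinearEquiv.finrank_map_eq (Sp.e.trans e.symm)]
  refine finrank_le_of_disjoint_of_isCompl hWQ ?_
  rw [Submodule.disjoint_def]
  rintro _ ⟨x, hx, rfl⟩ hx'
  by_contra h0
  have h1 := Sp.form_nonpos hx
  have h2 := hQ _ hx' h0
  simp at h2
  linarith

end FormSplitting

end Comparison

/-! ### Jumps of the negative eigenvalue count along a family -/

section Family

variable {H : Type*} [NormedAddCommGroup H] [InnerProductSpace ℂ H] [CompleteSpace H]
  {I : Set ℝ} {F : ℝ → H →ₗ.[ℂ] H} {D : Submodule ℂ H} {f f' : ℝ → D →ₗ⋆[ℂ] D →ₗ[ℂ] ℂ} {s : ℝ}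

/-- All forms `f t` are written, in the coordinates of the splitting at `s`, as forms of bounded
operators. No continuity in `t` is claimed beyond the differentiability of the forms at `s`. -/
theorem exists_transported_family (hI : I ∈ 𝓝 s)
    (hSp : ∀ t ∈ I, Nonempty (FormSplitting (F t) D fun y => f t y y))
    (hderiv : ∀ y : D, HasDerivAt (fun t => f t y y) (f' s y y) s)
    (Sp : FormSplitting (F s) D fun y => f s y y) :
    ∃ G : ℝ → H →L[ℂ] H, (∀ t ∈ I, ∀ x, f t (Sp.e x) (Sp.e x) = inner ℂ (G t x) x) ∧
      ∀ x, Tendsto (fun t => ((t - s : ℝ) : ℂ)⁻¹ * (inner ℂ (G t x) x - inner ℂ (G s x) x))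
        (𝓝[≠] s) (𝓝 (f' s (Sp.e x) (Sp.e x))) := by
  have h : ∀ t, ∃ G : H →L[ℂ] H, t ∈ I → ∀ x, f t (Sp.e x) (Sp.e x) = inner ℂ (G x) x := by
    intro t
    by_cases ht : t ∈ I
    · obtain ⟨Sp'⟩ := hSp t ht
      obtain ⟨G, hG⟩ := Sp.exists_form_eq_inner Sp'
      exact ⟨G, fun _ => hG⟩
    · exact ⟨0, fun h => absurd h ht⟩
  choose G hG using h
  refine ⟨G, hG, fun x => ?_⟩
  refine (hasDerivAt_iff_tendsto_slope.1 (hderiv (Sp.e x))).congr' ?_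
  filter_upwards [mem_nhdsWithin_of_mem_nhds hI] with t ht
  rw [slope_def_module, hG t ht, hG s (mem_of_mem_nhds hI), Complex.real_smul,
    Complex.ofReal_inv]

/-- The local step: when the forms decrease at `s` on the kernel of `F s`, the whole kernel turns
into negative directions to the right of `s` and into positive directions to the left of `s`. -/
theorem eventually_negEigenvalueCount_eq (hI : I ∈ 𝓝 s)
    (hSp : ∀ t ∈ I, Nonempty (FormSplitting (F t) D fun y => f t y y))
    (hderiv : ∀ y : D, HasDerivAt (fun t => f t y y) (f' s y y) s)
    (hneg : ∀ y : D, y ≠ 0 →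
      (∃ hy : (y : H) ∈ (F s).domain, F s ⟨(y : H), hy⟩ = 0) → (f' s y y).re < 0) :
    (∀ᶠ t in 𝓝[>] s, negEigenvalueCount (F t) =
        negEigenvalueCount (F s) + eigenMultiplicity (F s) 0 ∧ eigenMultiplicity (F t) 0 = 0) ∧
      ∀ᶠ t in 𝓝[<] s, negEigenvalueCount (F t) = negEigenvalueCount (F s) ∧
        eigenMultiplicity (F t) 0 = 0 := by
  obtain ⟨Sp⟩ := hSp s (mem_of_mem_nhds hI)
  have := Sp.finiteDimensional_neg
  have := Sp.finiteDimensional_ker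
  obtain ⟨G, hG, hb⟩ := exists_transported_family hI hSp hderiv Sp
  have hGs : ∀ x, inner ℂ (G s x) x = inner ℂ (Sp.G x) x := fun x =>
    (hG s (mem_of_mem_nhds hI) x).symm.trans (Sp.form_eq x)
  have hK : ∀ z ∈ Sp.ker, z ≠ 0 → (f' s (Sp.e z) (Sp.e z)).re < 0 := fun z hz hz0 =>
    hneg _ (by simpa using hz0) (Sp.map_eq_zero z hz)
  have hbot : ∀ {W : Submodule ℂ H} {p : H → Prop},
      (∀ z ∈ (⊥ : Submodule ℂ H), ∀ w ∈ W, z + w ≠ 0 → p (z + w)) → ∀ x ∈ W, x ≠ 0 → p x := by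
    intro W p h x hx hx0
    simpa using h 0 (Submodule.zero_mem _) x hx (by simpa using hx0)
  have hsup : ∀ {K W : Submodule ℂ H} {p : H → Prop},
      (∀ z ∈ K, ∀ w ∈ W, z + w ≠ 0 → p (z + w)) → ∀ x ∈ K ⊔ W, x ≠ 0 → p x := by
    intro K W p h x hx hx0
    obtain ⟨z, hz, w, hw, rfl⟩ := Submodule.mem_sup.1 hx
    exact h z hz w hw hx0
  have hnegG : ∀ z ∈ Sp.ker, ∀ w ∈ Sp.neg,
      Sp.c * ‖w‖ ^ 2 ≤ -1 * (inner ℂ (G s (z + w)) (z + w)).re := by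
    intro z hz w hw
    rw [hGs]
    linarith [Sp.form_neg z hz w hw]
  have hposG : ∀ z ∈ Sp.ker, ∀ w ∈ Sp.pos,
      Sp.c * ‖w‖ ^ 2 ≤ 1 * (inner ℂ (G s (z + w)) (z + w)).re := by
    intro z hz w hw
    rw [hGs, one_mul]
    exact Sp.form_pos z hz w hw
  have hbotle : ∀ z ∈ (⊥ : Submodule ℂ H), z ∈ Sp.ker := fun z hz => (bot_le : ⊥ ≤ Sp.ker) hz
  have hbot0 : ∀ {r : H → Prop}, ∀ z ∈ (⊥ : Submodule ℂ H), z ≠ 0 → r z :=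
    fun z hz hz0 => absurd ((Submodule.mem_bot ℂ).1 hz) hz0
  have hR : (𝓝[>] s : Filter ℝ) ≤ 𝓝[≠] s := nhdsGT_le_nhdsNE s
  have hL : (𝓝[<] s : Filter ℝ) ≤ 𝓝[≠] s := nhdsLT_le_nhdsNE s
  have hRκ : ∀ᶠ t in 𝓝[>] s, 0 < (1 : ℝ) * (t - s) := by
    filter_upwards [self_mem_nhdsWithin] with t ht
    have : s < t := ht
    linarith
  have hLκ : ∀ᶠ t in 𝓝[<] s, 0 < (-1 : ℝ) * (t - s) := by
    filter_upwards [self_mem_nhdsWithin] with t ht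
    have : t < s := ht
    linarith
  constructor
  · have h1 := eventually_re_inner_pos_of_tendsto_slope (η := -1) nhdsWithin_le_nhds (one_mul 1)
      hRκ (fun x => (hb x).mono_left hR) Sp.c_pos hnegG
      (fun z hz hz0 => by linarith [hK z hz hz0])
    have h2 := eventually_re_inner_pos_of_tendsto_slope (η := 1) nhdsWithin_le_nhds (one_mul 1)
      hRκ (fun x => (hb x).mono_left hR) Sp.c_pos (fun z hz => hposG z (hbotle z hz)) hbot0
    -- `f t` is negative on `neg ⊔ ker` and positive on its complement `pos`
    filter_upwards [h1, h2, mem_nhdsWithin_of_mem_nhds hI] with t h1 h2 ht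
    obtain ⟨Sp'⟩ := hSp t ht
    have h3 := Sp'.finrank_le_finrank_neg Sp.e (U := Sp.neg ⊔ Sp.ker) (by
      rw [sup_comm]
      intro x hx hx0
      have := hsup (p := fun x => 0 < -1 * (inner ℂ (G t x) x).re) h1 x hx hx0
      rw [hG t ht]
      linarith)
    have h4 := Sp'.finrank_neg_add_finrank_ker_le Sp.e (W := Sp.neg ⊔ Sp.ker) Sp.isCompl (by
      intro x hx hx0
      have := hbot (p := fun x => 0 < 1 * (inner ℂ (G t x) x).re) h2 x hx hx0
      rw [hG t ht]
      linarith)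
    rw [Sp.finrank_neg_sup_ker] at h3 h4
    rw [Sp'.negEigenvalueCount_eq, Sp.negEigenvalueCount_eq, Sp'.eigenMultiplicity_eq,
      Sp.eigenMultiplicity_eq]
    norm_cast
    omega
  · have h1 := eventually_re_inner_pos_of_tendsto_slope (η := -1) (κ := -1) nhdsWithin_le_nhds
      (by norm_num) hLκ (fun x => (hb x).mono_left hL) Sp.c_pos
      (fun z hz => hnegG z (hbotle z hz)) hbot0
    have h2 := eventually_re_inner_pos_of_tendsto_slope (η := 1) (κ := -1) nhdsWithin_le_nhds
      (by norm_num) hLκ (fun x => (hb x).mono_left hL) Sp.c_pos hposG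
      (fun z hz hz0 => by linarith [hK z hz hz0])
    -- `f t` is negative on `neg` and positive on its complement `ker ⊔ pos`
    filter_upwards [h1, h2, mem_nhdsWithin_of_mem_nhds hI] with t h1 h2 ht
    obtain ⟨Sp'⟩ := hSp t ht
    have h3 := Sp'.finrank_le_finrank_neg Sp.e (U := Sp.neg) (by
      intro x hx hx0
      have := hbot (p := fun x => 0 < -1 * (inner ℂ (G t x) x).re) h1 x hx hx0
      rw [hG t ht]
      linarith)
    have h4 := Sp'.finrank_neg_add_finrank_ker_le Sp.e (W := Sp.neg) Sp.isCompl_neg (by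
      intro x hx hx0
      have := hsup (p := fun x => 0 < 1 * (inner ℂ (G t x) x).re) h2 x hx hx0
      rw [hG t ht]
      linarith)
    rw [Sp'.negEigenvalueCount_eq, Sp.negEigenvalueCount_eq, Sp'.eigenMultiplicity_eq]
    norm_cast
    omega

end Family

/-! ### The count over the interval -/

theorem isOpen_realInterval (σ τ : EReal) : IsOpen (realInterval σ τ) :=
  (isOpen_lt continuous_const continuous_coe_real_ereal).inter
    (isOpen_lt continuous_coe_real_ereal continuous_const)

theorem mainTheorem3 {H : Type*} [NormedAddCommGroup H] [InnerProductSpace ℂ H] [CompleteSpace H]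
    (σ τ : EReal) (F : ℝ → H →ₗ.[ℂ] H)
    (hF : IsSelfAdjointFamily (realInterval σ τ) F)
    (D : Submodule ℂ H) (f f' : ℝ → D →ₗ⋆[ℂ] D →ₗ[ℂ] ℂ)
    (hclosure : ∀ s ∈ realInterval σ τ, IsFormClosure (F s) D (f s))
    (hbounded : ∃ p : Seminorm ℂ D, IsCompleteNorm p ∧
      ∃ C : ℝ, ∀ s ∈ realInterval σ τ, ∀ y : D, ‖f' s y y‖ ≤ C * p y ^ 2)
    (hderiv : ∀ s ∈ realInterval σ τ, ∀ y : D, HasDerivAt (fun t => f t y y) (f' s y y) s)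
    (hneg : ∀ s ∈ realInterval σ τ, ∀ y : D, y ≠ 0 →
      (∃ hy : (y : H) ∈ (F s).domain, F s ⟨(y : H), hy⟩ = 0) → (f' s y y).re < 0)
    (ξ₁ ξ₂ : ℝ) (hξ₁ : σ < (ξ₁ : EReal)) (hξ : ξ₁ < ξ₂) (hξ₂ : (ξ₂ : EReal) < τ) :
    ∃ N ν₁ ν₂ : ℕ, familyEigenvalueCount F ξ₁ ξ₂ = N ∧
      negEigenvalueCount (F ξ₁) = ν₁ ∧ negEigenvalueCount (F ξ₂) = ν₂ ∧
      (N : ℤ) = (ν₂ : ℤ) - (ν₁ : ℤ) := by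
  have hIcc : Set.Icc ξ₁ ξ₂ ⊆ realInterval σ τ := fun s hs =>
    ⟨hξ₁.trans_le (EReal.coe_le_coe_iff.2 hs.1), (EReal.coe_le_coe_iff.2 hs.2).trans_lt hξ₂⟩
  have hSp : ∀ t ∈ realInterval σ τ, Nonempty (FormSplitting (F t) D fun y => f t y y) := by
    intro t ht
    obtain ⟨μ, U, hU, -, hμ⟩ := hF.locallyBoundedBelow t ht
    exact (hclosure t ht).nonempty_formSplitting (hF.selfAdjoint t ht) (hF.compactResolvent t ht)
      (hμ t (mem_of_mem_nhds hU))
  let ν : ℝ → ℕ := fun s => (negEigenvalueCount (F s)).toNat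
  let m : ℝ → ℕ := fun s => (eigenMultiplicity (F s) 0).toNat
  have hν : ∀ s ∈ realInterval σ τ, negEigenvalueCount (F s) = ν s := by
    intro s hs
    obtain ⟨Sp⟩ := hSp s hs
    simp [ν, Sp.negEigenvalueCount_eq]
  have hm : ∀ s ∈ realInterval σ τ, eigenMultiplicity (F s) 0 = m s := by
    intro s hs
    obtain ⟨Sp⟩ := hSp s hs
    simp [m, Sp.eigenMultiplicity_eq]
  have hloc : ∀ s ∈ Set.Icc ξ₁ ξ₂, _ := fun s hs => eventually_negEigenvalueCount_eq
    ((isOpen_realInterval σ τ).mem_nhds (hIcc hs)) hSp (hderiv s (hIcc hs)) (hneg s (hIcc hs))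
  have hnhds : ∀ s ∈ Set.Icc ξ₁ ξ₂, ∀ S : Set ℝ, ∀ᶠ t in 𝓝[S] s, t ∈ realInterval σ τ :=
    fun s hs S => mem_nhdsWithin_of_mem_nhds ((isOpen_realInterval σ τ).mem_nhds (hIcc hs))
  have hcount : familyEigenvalueCount F ξ₁ ξ₂ + ν ξ₁ = ν ξ₂ := by
    have h1 : familyEigenvalueCount F ξ₁ ξ₂ = ∑' s : Set.Ico ξ₁ ξ₂, (m s : ℕ∞) :=
      tsum_congr fun s => hm s (hIcc (Set.Ico_subset_Icc_self s.2))
    rw [h1]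
    refine tsum_Ico_add_eq_of_eventually hξ.le (fun s hs => ?_) fun s hs => ?_
    · filter_upwards [(hloc s hs).1, hnhds s hs _] with t ht htI
      rw [hν t htI, hm t htI, hν s (hIcc hs), hm s (hIcc hs)] at ht
      exact_mod_cast ht
    · filter_upwards [(hloc s hs).2, hnhds s hs _] with t ht htI
      rw [hν t htI, hm t htI, hν s (hIcc hs)] at ht
      exact_mod_cast ht
  have hN : familyEigenvalueCount F ξ₁ ξ₂ ≠ ⊤ := fun h => by
    rw [h, top_add] at hcount
    exact ENat.natCast_ne_top _ hcount.symm
  obtain ⟨N, hN⟩ := ENat.ne_top_iff_exists.1 hN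
  rw [← hN] at hcount
  refine ⟨N, ν ξ₁, ν ξ₂, hN.symm, hν _ (hIcc (Set.left_mem_Icc.2 hξ.le)),
    hν _ (hIcc (Set.right_mem_Icc.2 hξ.le)), ?_⟩
  have : N + ν ξ₁ = ν ξ₂ := by exact_mod_cast hcount
  omega
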